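/- **Formulas and models.** Consider structures $(M,d,\sqsubset)$ with $(M,d)$ a complete metric space, $d$ $[0,1]$-valued, and $\sqsubset$ a closed binary relation ("membership") on $M$ such that $d(a,b)=d_H(\{x:x\sqsubset a\},\{x:x\sqsubset b\})$ for all $a,b\in M$, where $d_H$ is the Hausdorff distance truncated at $1$. *Formulas* are built from $1$ and $d(x,y)$ by $\varphi+\psi$, $\max$, $\min$, $r\cdot\varphi$ ($r\in\mathbb R$), $\sup_x,\inf_x$, and the bounded quantifiers $\sup_{x\sqsubset y},\inf_{x\sqsubset y}$. Put $v(1)=v(d(x,y))=1$, $v(\varphi+\psi)=v(\varphi)+v(\psi)$, $v(\max(\varphi,\psi))=v(\min(\varphi,\psi))=\max(v(\varphi),v(\psi))$, $v(r\varphi)=|r|v(\varphi)$, and let quantifiers not change $v$. Formulas are evaluated in $M$ as real-valued functions in the obvious way, where $\sup_{x\sqsubset a}\varphi=-v(\varphi)$ and $\inf_{x\sqsubset a}\varphi=v(\varphi)$ if $a$ has no elements. $M$ is a *model of* $\mathsf{MSE}$ if moreover for every formula $\varphi(x,\bar y)$, all reals $r<s$ and every tuple $\bar a$ in $M$ there is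 $b\in M$ such that for all $c\in M$: $\varphi^M(c,\bar a)\le r$ implies $c\sqsubset b$, and $c\sqsubset b$ implies $\varphi^M(c,\bar a)<s$. Write $e(x,y)=\inf_{z\sqsubset y}d(x,z)$. In such a model pairs $\langle a,b\rangle=\{\{\{a\},\varnothing\},\{\{b\}\}\}$, products $a\times b$ and power sets $\mathcal P(a)$ exist. An element $a\in M$ is *$s$-discrete* if any two distinct $b,c\sqsubset a$ satisfy $d(b,c)\ge s$. **Infinite sets.** *Discrete formulas* over a type variable $a$ are two-valued formulas built from $x=y$, $\langle x,y\rangle=z$ and $x\sqsubset y$ by Boolean connectives and quantifiers over types, the types being generated from $a$ by $\times$ and $\mathcal P$; they are interpreted in $(M,\sqsubset)$. $\mathrm{Inf}(a)$ is the discrete sentence $|a|_a\not\sqsubset\mathbb N_a$. Here $|b|_a$ is the set of all $c\sqsubset\mathcal P(a)$ for which some $h\sqsubset\mathcal P(a\times a)$ is the graph of a bijection between $b$ and $c$; $0=\{\varnothing\}$; $\mathrm{succ}_a(n)$ is the set of all $c\sqsubset\mathcal P(a)$ such that for some $f\sqsubset n$, $f$ is a subset of $c$ and exactly one element of $c$ is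 not in $f$; and $\mathbb N_a$ is the set of all $n\sqsubset\mathcal P^2(a)$ that belong to every $y\sqsubset\mathcal P^3(a)$ with $0\sqsubset y$ and, for all $m\sqsubset y$, $\mathrm{succ}_a(m)\sqsubset y$ or $\mathrm{succ}_a(m)=\varnothing$. For $\varepsilon>0$ a discrete formula $\Phi$ is turned into a real-valued formula $[\![\Phi]\!]_\varepsilon$ by $[\![x=y]\!]_\varepsilon=\max(1-\tfrac1\varepsilon d(x,y),0)$, $[\![\langle x,y\rangle=z]\!]_\varepsilon=\max(1-\tfrac1\varepsilon d(\langle x,y\rangle,z),0)$, $[\![x\sqsubset y]\!]_\varepsilon=\max(1-\tfrac1\varepsilon e(x,y),0)$, $[\![\Phi\wedge\Psi]\!]_\varepsilon=\min([\![\Phi]\!]_\varepsilon,[\![\Psi]\!]_\varepsilon)$, $[\![\neg\Phi]\!]_\varepsilon=1-[\![\Phi]\!]_\varepsilon$, $[\![(\exists x{:}b)\Phi]\!]_\varepsilon=\sup_{x\sqsubset b}[\![\Phi]\!]_\varepsilon$. (Distances to pairs and quantifiers over products and power sets are expressed by formulas: a supremum over a class with distance predicate $D$ is $\sup_x\max(\varphi(x)-2v(\varphi)D(x),-v(\varphi))$.)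 **Axioms of infinity.** For $r>0$ let $\varphi_r(x)=\sup_{z,y\sqsubset x}\min(d(y,z),r-d(y,z))$ and $E_r(x,y)=\max(\min(\tfrac1r(2r-3d(x,y)),1),0)$. If $\varphi_r^M(x)<\tfrac r3$, then $E_r=1$ is an equivalence relation on the elements of $x$; let $f_r(x)$ be the set of its classes, and let $\psi_r(x,z)$ be a parameter-free formula with $\psi_r^M(x,z)=d(f_r(x),z)$ for all such $x$ and all $z\in M$. For $r,\varepsilon>0$ with $\varepsilon<\tfrac r3$, $\mathrm{Inf}_{r,\varepsilon}$ is the condition $$\sup_x\min\bigl(1+\varepsilon-\varphi_r(x),\ \inf_z\bigl([\![\mathrm{Inf}(z)]\!]_{r/3}+2v([\![\mathrm{Inf}(-)]\!]_{r/3})\,\psi_r(x,z)\bigr)\bigr)\ \ge\ 1,$$ and $\mathrm{Inf}$ is the scheme $\{\mathrm{Inf}_{1,\varepsilon}:0<\varepsilon<\tfrac13\}$. **Proposition.** Let $M$ be a model of $\mathsf{MSE}$. 1. For any $r,\varepsilon>0$ with $\varepsilon<\tfrac13r$, $M\models\mathrm{Inf}_{r,\varepsilon}$ if and only if for every $s\in(0,r-\varepsilon)$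 there is an $s$-discrete $a\in M$ such that $M\models\mathrm{Inf}(a)$. 2. $M\models\mathrm{Inf}$ if and only if for every $r\in(0,1)$ there is an $r$-discrete $a\in M$ such that $M\models\mathrm{Inf}(a)$. -/

import Mathlib

namespace MSE

/-! ### Real-valued formulas -/

/-- Real-valued formulas with free variables among `x₀, …, xₙ₋₁`, written with de Bruijn indices: a
quantifier binds variable `0` of its body and shifts the variables of the context by `Fin.succ`.
`bsup y φ` and `binf y φ` are the bounded quantifiers `sup_{x ⊑ y} φ` and `inf_{x ⊑ y} φ`. -/
inductive Formula : ℕ → Type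
  | one {n : ℕ} : Formula n
  | dist {n : ℕ} (x y : Fin n) : Formula n
  | plus {n : ℕ} (φ ψ : Formula n) : Formula n
  | max {n : ℕ} (φ ψ : Formula n) : Formula n
  | min {n : ℕ} (φ ψ : Formula n) : Formula n
  | smul {n : ℕ} (r : ℝ) (φ : Formula n) : Formula n
  | sup {n : ℕ} (φ : Formula (n + 1)) : Formula n
  | inf {n : ℕ} (φ : Formula (n + 1)) : Formula n
  | bsup {n : ℕ} (y : Fin n) (φ : Formula (n + 1)) : Formula n
  | binf {n : ℕ} (y : Fin n) (φ : Formula (n + 1)) : Formula n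

namespace Formula

/-- The a priori bound `v(φ)` of a formula. -/
noncomputable def v : {n : ℕ} → Formula n → ℝ
  | _, one => 1
  | _, dist _ _ => 1
  | _, plus φ ψ => φ.v + ψ.v
  | _, max φ ψ => Max.max φ.v ψ.v
  | _, min φ ψ => Max.max φ.v ψ.v
  | _, smul r φ => |r| * φ.v
  | _, sup φ => φ.v
  | _, inf φ => φ.v
  | _, bsup _ φ => φ.v
  | _, binf _ φ => φ.v

open Classical in
/-- The value `φ^M(a)` in the structure `(M, d, mem)`. Bounded suprema and infima over the empty
set are `-v(φ)` and `v(φ)`. -/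
noncomputable def eval {M : Type*} [MetricSpace M] (mem : M → M → Prop) :
    {n : ℕ} → Formula n → (Fin n → M) → ℝ
  | _, one, _ => 1
  | _, dist x y, a => Dist.dist (a x) (a y)
  | _, plus φ ψ, a => φ.eval mem a + ψ.eval mem a
  | _, max φ ψ, a => Max.max (φ.eval mem a) (ψ.eval mem a)
  | _, min φ ψ, a => Min.min (φ.eval mem a) (ψ.eval mem a)
  | _, smul r φ, a => r * φ.eval mem a
  | _, sup φ, a => ⨆ b : M, φ.eval mem (Matrix.vecCons b a)
  | _, inf φ, a => ⨅ b : M, φ.eval mem (Matrix.vecCons b a)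
  | _, bsup y φ, a =>
      if ∃ c, mem c (a y) then ⨆ c : {c : M // mem c (a y)}, φ.eval mem (Matrix.vecCons c.1 a)
      else -φ.v
  | _, binf y φ, a =>
      if ∃ c, mem c (a y) then ⨅ c : {c : M // mem c (a y)}, φ.eval mem (Matrix.vecCons c.1 a)
      else φ.v

/-! Shorthand for constants, differences and absolute values. -/

def const {n : ℕ} (r : ℝ) : Formula n := smul r one

def sub {n : ℕ} (φ ψ : Formula n) : Formula n := plus φ (smul (-1) ψ)

def abs {n : ℕ} (φ : Formula n) : Formula n := max φ (smul (-1) φ)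

/-- `e(x, y) = inf_{z ⊑ y} d(x, z)`. -/
def e {n : ℕ} (x y : Fin n) : Formula n := binf y (dist x.succ 0)

end Formula

/-! ### Metric set structures and models of MSE -/

/-- `(M, d, mem)` is a metric set structure: `M` is complete, `d` is `[0,1]`-valued, `mem` is closed,
and the distance between two elements is the Hausdorff distance, truncated at `1`, between their
extensions. -/
structure IsMetricSetStructure {M : Type*} [MetricSpace M] (mem : M → M → Prop) : Prop where
  complete : CompleteSpace M
  dist_le_one : ∀ a b : M, dist a b ≤ 1
  closed : IsClosed {p : M × M | mem p.1 p.2}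
  h_extensional : ∀ a b : M,
    edist a b = min 1 (Metric.hausdorffEDist {x | mem x a} {x | mem x b})

/-- Excision: for every formula `φ(x, y₀, …, yₙ₋₁)`, reals `r < s` and parameters `a`, some set
contains `{x : φ(x, a) ≤ r}` and is contained in `{x : φ(x, a) < s}`. -/
def Excision {M : Type*} [MetricSpace M] (mem : M → M → Prop) : Prop :=
  ∀ (n : ℕ) (φ : Formula (n + 1)) (r s : ℝ), r < s → ∀ a : Fin n → M, ∃ b : M, ∀ c : M,
    (φ.eval mem (Matrix.vecCons c a) ≤ r → mem c b) ∧
    (mem c b → φ.eval mem (Matrix.vecCons c a) < s)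

/-- `(M, d, mem)` is a model of MSE. -/
structure IsModel {M : Type*} [MetricSpace M] (mem : M → M → Prop) : Prop where
  isMetricSetStructure : IsMetricSetStructure mem
  excision : Excision mem

/-- `a` is `ε`-discrete. -/
def IsDiscrete {M : Type*} [MetricSpace M] (mem : M → M → Prop) (ε : ℝ) (a : M) : Prop :=
  ∀ b c : M, mem b a → mem c a → b = c ∨ ε ≤ dist b c

/-- `p` is the (Wiener) ordered pair `⟨x, y⟩ = {{{x}, ∅}, {{y}}}`. -/
def IsPair {M : Type*} (mem : M → M → Prop) (p x y : M) : Prop :=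
  ∃ sx o q sy t : M,
    {c | mem c sx} = {x} ∧ {c | mem c o} = ∅ ∧ {c | mem c q} = {sx, o} ∧
    {c | mem c sy} = {y} ∧ {c | mem c t} = {sy} ∧ {c | mem c p} = {q, t}

/-! ### Discrete formulas -/

/-- Type expressions over `k` type variables. -/
inductive Ty (k : ℕ) : Type
  | base (i : Fin k) : Ty k
  | prod (b c : Ty k) : Ty k
  | pow (b : Ty k) : Ty k

/-- `Var Γ b`: the variables of type `b` in the context `Γ`. -/
inductive Var {k : ℕ} : List (Ty k) → Ty k → Type
  | z {Γ : List (Ty k)} {b : Ty k} : Var (b :: Γ) b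
  | s {Γ : List (Ty k)} {b c : Ty k} (x : Var Γ b) : Var (c :: Γ) b

/-- Assignments of values in `X` to the variables of a context. -/
def Env {k : ℕ} (Γ : List (Ty k)) (X : Type*) : Type _ := ∀ b : Ty k, Var Γ b → X

/-- The empty assignment. -/
def Env.nil {k : ℕ} {X : Type*} : Env ([] : List (Ty k)) X := fun _ x => nomatch x

/-- Extension of an assignment by a value for the newly bound variable. -/
def Env.cons {k : ℕ} {Γ : List (Ty k)} {X : Type*} {b : Ty k} (c : X) (ρ : Env Γ X) :
    Env (b :: Γ) X
  | _, .z => c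
  | _, .s x => ρ _ x

/-- Discrete formulas over `k` type variables, with free typed variables in the context `Γ`. The
remaining connectives and the universal quantifier are abbreviations. -/
inductive DisFormula {k : ℕ} : List (Ty k) → Type
  | eq {Γ : List (Ty k)} {b c : Ty k} (x : Var Γ b) (y : Var Γ c) : DisFormula Γ
  | pair {Γ : List (Ty k)} {b c : Ty k} (x : Var Γ b) (y : Var Γ c) (p : Var Γ (b.prod c)) :
      DisFormula Γ
  | mem {Γ : List (Ty k)} {b : Ty k} (x : Var Γ b) (y : Var Γ b.pow) : DisFormula Γ
  | and {Γ : List (Ty k)} (Φ Ψ : DisFormula Γ) : DisFormula Γ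
  | not {Γ : List (Ty k)} (Φ : DisFormula Γ) : DisFormula Γ
  | ex {Γ : List (Ty k)} (b : Ty k) (Φ : DisFormula (b :: Γ)) : DisFormula Γ

namespace DisFormula

def or {k : ℕ} {Γ : List (Ty k)} (Φ Ψ : DisFormula Γ) : DisFormula Γ := not (and (not Φ) (not Ψ))

def imp {k : ℕ} {Γ : List (Ty k)} (Φ Ψ : DisFormula Γ) : DisFormula Γ := not (and Φ (not Ψ))

def iff {k : ℕ} {Γ : List (Ty k)} (Φ Ψ : DisFormula Γ) : DisFormula Γ := and (imp Φ Ψ) (imp Ψ Φ)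

def all {k : ℕ} {Γ : List (Ty k)} (b : Ty k) (Φ : DisFormula (b :: Γ)) : DisFormula Γ :=
  not (ex b (not Φ))

end DisFormula

/-- `c` is an element of the set that the type expression denotes when the type variables are
interpreted by `A`; here `pow` is the power set and `prod` the Cartesian product. -/
def Ty.Mem {M : Type*} (mem : M → M → Prop) {k : ℕ} (A : Fin k → M) : Ty k → M → Prop
  | .base i, c => mem c (A i)
  | .prod s t, c => ∃ x y : M, s.Mem mem A x ∧ t.Mem mem A y ∧ IsPair mem c x y
  | .pow t, c => ∀ u : M, mem u c → t.Mem mem A u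

/-- Satisfaction of a discrete formula in `(M, mem)`. -/
def DisFormula.Sat {M : Type*} (mem : M → M → Prop) {k : ℕ} (A : Fin k → M) :
    {Γ : List (Ty k)} → DisFormula Γ → Env Γ M → Prop
  | _, .eq x y, ρ => ρ _ x = ρ _ y
  | _, .pair x y p, ρ => IsPair mem (ρ _ p) (ρ _ x) (ρ _ y)
  | _, .mem x y, ρ => mem (ρ _ x) (ρ _ y)
  | _, .and Φ Ψ, ρ => Φ.Sat mem A ρ ∧ Ψ.Sat mem A ρ
  | _, .not Φ, ρ => ¬ Φ.Sat mem A ρ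
  | _, .ex b Φ, ρ => ∃ c : M, b.Mem mem A c ∧ Φ.Sat mem A (ρ.cons c)

/-! ### The discrete sentence `Inf(a)` -/

namespace DisFormula

/-- The single type variable. -/
abbrev tyA : Ty 1 := .base 0

/-- `⟨x, y⟩ ⊑ h`, for a relation `h ⊑ a × a`. -/
def rel {Γ : List (Ty 1)} (x y : Var Γ tyA) (h : Var Γ (tyA.prod tyA).pow) : DisFormula Γ :=
  ex (tyA.prod tyA) (and (pair x.s y.s .z) (mem .z h.s))

/-- `u ≈_a w`: some `h ⊑ a × a` is the graph of a bijection between `u` and `w`. -/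
def equinum {Γ : List (Ty 1)} (u w : Var Γ tyA.pow) : DisFormula Γ :=
  ex (tyA.prod tyA).pow
    (and
      -- every element of `h` is a pair `⟨x, y⟩` with `x ⊑ u` and `y ⊑ w`
      (all (tyA.prod tyA) (imp (mem .z (.s .z))
        (ex tyA (ex tyA (and (pair (.s .z) .z (.s (.s .z)))
          (and (mem (.s .z) u.s.s.s.s) (mem .z w.s.s.s.s)))))))
      (and
        -- every `x ⊑ u` is related to exactly one `y`
        (all tyA (imp (mem .z u.s.s)
          (ex tyA (and (rel (.s .z) .z (.s (.s .z)))
            (all tyA (imp (rel (.s (.s .z)) .z (.s (.s (.s .z)))) (eq .z (.s .z))))))))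
        -- exactly one `x` is related to a given `y ⊑ w`
        (all tyA (imp (mem .z w.s.s)
          (ex tyA (and (rel .z (.s .z) (.s (.s .z)))
            (all tyA (imp (rel .z (.s (.s .z)) (.s (.s (.s .z)))) (eq .z (.s .z))))))))))

/-- `n = 0`, where `0 = {∅}`. -/
def isZero {Γ : List (Ty 1)} (n : Var Γ tyA.pow.pow) : DisFormula Γ :=
  all tyA.pow (iff (mem .z n.s) (all tyA (not (mem .z (.s .z)))))

/-- `m = succ_a(n)`: the elements of `m` are the `c ⊑ a` for which there is an `f ⊑ n` with `f` a
subset of `c` and exactly one `g` in `c` that is not in `f`. -/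
def isSucc {Γ : List (Ty 1)} (n m : Var Γ tyA.pow.pow) : DisFormula Γ :=
  all tyA.pow (iff (mem .z m.s)
    (ex tyA.pow (and (mem .z n.s.s)
      (and (all tyA (imp (mem .z (.s .z)) (mem .z (.s (.s .z)))))
        (ex tyA (and (and (mem .z (.s (.s .z))) (not (mem .z (.s .z))))
          (all tyA (imp (and (mem .z (.s (.s (.s .z)))) (not (mem .z (.s (.s .z)))))
            (eq .z (.s .z))))))))))

/-- `ind_a(x)`: `0 ⊑ x`, and for every `n ⊑ x`, `succ_a(n) ⊑ x` or `succ_a(n) = ∅`. -/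
def isInductive {Γ : List (Ty 1)} (x : Var Γ tyA.pow.pow.pow) : DisFormula Γ :=
  and (ex tyA.pow.pow (and (isZero .z) (mem .z x.s)))
    (all tyA.pow.pow (imp (mem .z x.s)
      (ex tyA.pow.pow (and (isSucc (.s .z) .z)
        (or (mem .z x.s.s) (all tyA.pow (not (mem .z (.s .z)))))))))

/-- `n ⊑ ℕ_a`: `n` belongs to every inductive set. -/
def isNat {Γ : List (Ty 1)} (n : Var Γ tyA.pow.pow) : DisFormula Γ :=
  all tyA.pow.pow.pow (imp (isInductive .z) (mem n.s .z))

/-- `n = |a|_a`: the elements of `n` are the subsets of `a` equinumerous with `a`. -/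
def isCard {Γ : List (Ty 1)} (n : Var Γ tyA.pow.pow) : DisFormula Γ :=
  ex tyA.pow (and (all tyA (mem .z (.s .z)))
    (all tyA.pow (iff (mem .z n.s.s) (equinum .z (.s .z)))))

/-- `Inf(a)`: the cardinal `|a|_a` is not in `ℕ_a`. -/
def infinite : DisFormula ([] : List (Ty 1)) :=
  ex tyA.pow.pow (and (isCard .z) (not (isNat .z)))

end DisFormula

/-- `M ⊨ Inf(a)`. -/
def IsInf {M : Type*} (mem : M → M → Prop) (a : M) : Prop :=
  DisFormula.infinite.Sat mem ![a] Env.nil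

/-! ### Discrete formulas as real-valued formulas -/

namespace Formula

/-- If `D(w)` is the distance from `w` to the elements of a set `b`, this is `d(z, b)`, as
`sup_w |e(w, z) - D(w)|`. -/
def distSet {n : ℕ} (z : Fin n) (D : Formula (n + 1)) : Formula n := sup (abs (sub (e 0 z.succ) D))

/-- `d(z, ∅)`. -/
def distEmpty {n : ℕ} (z : Fin n) : Formula n := sub one (binf z (dist 0 0))

/-- `d(z, {x})`. -/
def distSingleton {n : ℕ} (z x : Fin n) : Formula n := distSet z (dist 0 x.succ)

/-- `d(z, ⟨x, y⟩) = d(z, {{{x}, ∅}, {{y}}})`. -/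
def distPair {n : ℕ} (z x y : Fin n) : Formula n :=
  distSet z (min
    (distSet 0 (min (distSingleton 0 x.succ.succ) (distEmpty 0)))
    (distSet 0 (distSingleton 0 y.succ.succ)))

/-- `inf {φ(x) : x ∈ C}` for a class `C` with distance predicate `D`, the infimum over the empty
class being `v(φ)`. -/
noncomputable def infRel {n : ℕ} (D φ : Formula (n + 1)) : Formula n :=
  inf (min (plus φ (smul (2 * φ.v) D)) (const φ.v))

/-- `sup {φ(x) : x ∈ C}` for a class `C` with distance predicate `D`, the supremum over the empty
class being `-v(φ)`. -/
noncomputable def supRel {n : ℕ} (D φ : Formula (n + 1)) : Formula n :=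
  sup (max (sub φ (smul (2 * φ.v) D)) (const (-φ.v)))

/-- The value at `b` of `φ(y)` when `χ(y) = d(b, y)`. -/
noncomputable def subst {n : ℕ} (χ φ : Formula (n + 1)) : Formula n :=
  inf (plus φ (smul (2 * φ.v) χ))

end Formula

open Formula in
/-- The distance predicate of the set denoted by a type expression, as a formula in the variable `w`
and in the variables `A` that interpret the type variables. -/
noncomputable def Ty.distPred {k : ℕ} : Ty k → {n : ℕ} → (Fin k → Fin n) → Fin n → Formula n
  | .base i, _, A, w => e w (A i)
  | .prod s t, _, A, w =>
      min one (infRel (s.distPred (fun i => (A i).succ) 0)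
        (infRel (t.distPred (fun i => (A i).succ.succ) 0) (distPair w.succ.succ 1 0)))
  | .pow t, _, A, w => max (const 0) (bsup w (t.distPred (fun i => (A i).succ) 0))

open Formula in
/-- The real-valued formula `⟦Φ⟧_ε`; the variables of `Φ` and the type variables are replaced by the
variables `ρ` and `A`. -/
noncomputable def DisFormula.toFormula {k : ℕ} (ε : ℝ) : {Γ : List (Ty k)} → DisFormula Γ →
    {n : ℕ} → (Fin k → Fin n) → Env Γ (Fin n) → Formula n
  | _, .eq x y, _, _, ρ => max (sub one (smul (1 / ε) (dist (ρ _ x) (ρ _ y)))) (const 0)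
  | _, .pair x y p, _, _, ρ =>
      max (sub one (smul (1 / ε) (distPair (ρ _ p) (ρ _ x) (ρ _ y)))) (const 0)
  | _, .mem x y, _, _, ρ => max (sub one (smul (1 / ε) (e (ρ _ x) (ρ _ y)))) (const 0)
  | _, .and Φ Ψ, _, A, ρ => min (Φ.toFormula ε A ρ) (Ψ.toFormula ε A ρ)
  | _, .not Φ, _, A, ρ => sub one (Φ.toFormula ε A ρ)
  | _, .ex b Φ, _, A, ρ =>
      supRel (b.distPred (fun i => (A i).succ) 0)
        (Φ.toFormula ε (fun i => (A i).succ) (Env.cons 0 (fun c x => (ρ c x).succ)))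

/-! ### The axioms of infinity -/

namespace Formula

/-- `φ_r(x) = sup_{z, y ⊑ x} min(d(y, z), r - d(y, z))`. -/
noncomputable def gap (r : ℝ) {n : ℕ} (x : Fin n) : Formula n :=
  bsup x (bsup x.succ (min (dist 0 1) (sub (const r) (dist 0 1))))

/-- `E_r(x, y) = max(min((2 r - 3 d(x, y)) / r, 1), 0)`. -/
noncomputable def equivE (r : ℝ) {n : ℕ} (x y : Fin n) : Formula n :=
  max (min (smul (1 / r) (sub (const (2 * r)) (smul 3 (dist x y)))) one) (const 0)

/-- `d(w, [b])`, where `[b]` is the class of `b ⊑ x` for the equivalence relation `E_r` on `x`. The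
distance from `u` to that class is `inf_{y ⊑ x} max(1 - E_r(y, b), d(u, y))`. -/
noncomputable def distClass (r : ℝ) {n : ℕ} (w b x : Fin n) : Formula n :=
  distSet w (binf x.succ (max (sub one (equivE r 0 b.succ.succ)) (dist 1 0)))

/-- `ψ_r(x, z) = d(z, f_r(x))`, where `f_r(x)` is the set of `E_r`-classes of `x`, for `x` with
`φ_r(x) < r / 3`. The distance from `w` to that set is `inf_{b ⊑ x} d(w, [b])`, or `1` if `x` is
empty. -/
noncomputable def distQuot (r : ℝ) {n : ℕ} (x z : Fin n) : Formula n :=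
  distSet z (min one (binf x.succ (distClass r 1 0 x.succ.succ)))

/-- `sup_x min(1 + ε - φ_r(x), ⟦Inf(f_r(x))⟧_{r/3})`. -/
noncomputable def infinity (r ε : ℝ) : Formula 0 :=
  sup (min (sub (const (1 + ε)) (gap r 0))
    (subst (distQuot r 1 0) (DisFormula.infinite.toFormula (r / 3) (fun _ => 0) Env.nil)))

end Formula

/-- `M ⊨ Inf_{r,ε}`. -/
def SatInf {M : Type*} [MetricSpace M] (mem : M → M → Prop) (r ε : ℝ) : Prop :=
  1 ≤ (Formula.infinity r ε).eval mem ![]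

/-- `M ⊨ Inf`, the scheme `{Inf_{1,ε} : 0 < ε < 1/3}`. -/
def SatInfScheme {M : Type*} [MetricSpace M] (mem : M → M → Prop) : Prop :=
  ∀ ε : ℝ, 0 < ε → ε < 1 / 3 → SatInf mem 1 ε

end MSE

/-! Suppose `Inf_{r,ε}` holds. Since a supremum need only be approached, for small `δ` there is `X`
with `φ_r(X) < ε + δ`: distances inside `X` are at most `ε + δ` or at least `r - (ε + δ)`. "Being
close" is then an equivalence relation, and the set `f` of its classes is `(r - ε - δ)`-discrete.
Evaluating the inner infimum at `z = f`, where `ψ_r` vanishes, gives `⟦Inf(f)⟧_{r/3} > 1 - δ`. Over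
an `r/3`-discrete set with `r ≤ 3` the translation is two-valued in effect: at least `1` if the
sentence is true, at most `0` if it is false (`DisFormula.eval_toFormula`). Hence `f` is infinite.

Conversely, let `a` be infinite and `s`-discrete with `s` just below `r - ε`. Its classes are
singletons, so `f` is the set of singletons of `a`. It is infinite as well, because `b ↦ {b}`
induces a bijection between the types over `a` and those over `f` that preserves equality, pairing
and membership (`IsModel.corrBijective`, `DisFormula.sat_congr`). So `⟦Inf(f)⟧_{r/3} ≥ 1`, and the
penalty `2v·ψ_r` keeps the infimum over `z` at least `1` because formulas are `2v`-Lipschitz.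

If `r > 3` both sides fail. Distances are at most `1`, so `⟦Inf⟧_{r/3} ≤ 3/r < 1`; and a
`2`-discrete set has at most one element, hence is not infinite.

Three facts support this. Formulas are Lipschitz (`eval_le_eval_add`), so the relativized
quantifiers compute infima and suprema over classes. Closed classes with a definable distance are
sets (`exists_of_isDef`), and inside discrete sets excision becomes exact comprehension
(`exists_separation`, `exists_comprehension`). Finally, `δ`-discreteness passes from a set to all
types over it (`Ty.eq_or_le_dist`). -/

namespace MSE

variable {M : Type*} [MetricSpace M] {mem : M → M → Prop}

/-- A Hausdorff distance or an infimum `D` only provides witnesses at distance below each `η > D`,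
and truncation requires `η ≤ 1`. This limit `η → D⁺` recovers the sharp estimate. -/
theorem le_add_mul_of_forall_lt {t p c D B : ℝ} (hD : D < B)
    (h : ∀ η, D < η → η < B → t ≤ p + c * η) : t ≤ p + c * D := by
  have h1 : Filter.Tendsto (fun η => p + c * η) (nhdsWithin D (Set.Ioi D)) (nhds (p + c * D)) :=
    (Continuous.tendsto (by fun_prop) D).mono_left nhdsWithin_le_nhds
  refine ge_of_tendsto h1 ?_
  filter_upwards [Ioo_mem_nhdsGT hD] with η hη using h η hη.1 hη.2

/-! ### Values of formulas -/

theorem Formula.v_nonneg : ∀ {n : ℕ} (φ : Formula n), 0 ≤ φ.v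
  | _, .one => zero_le_one
  | _, .dist _ _ => zero_le_one
  | _, .plus φ ψ => add_nonneg φ.v_nonneg ψ.v_nonneg
  | _, .max φ _ => φ.v_nonneg.trans (le_max_left _ _)
  | _, .min φ _ => φ.v_nonneg.trans (le_max_left _ _)
  | _, .smul r φ => mul_nonneg (abs_nonneg r) φ.v_nonneg
  | _, .sup φ => φ.v_nonneg
  | _, .inf φ => φ.v_nonneg
  | _, .bsup _ φ => φ.v_nonneg
  | _, .binf _ φ => φ.v_nonneg

/-! ### Hausdorff matching, bounds and Lipschitz continuity of values, limits of extensions -/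

namespace IsMetricSetStructure

/-- The bound `η ≤ 1` is essential: the distance is truncated, so only a value below `1` says
anything about the Hausdorff distance. -/
theorem exists_dist_lt (hM : IsMetricSetStructure mem) {a b x : M} {η : ℝ} (hx : mem x a)
    (hab : dist a b < η) (hη : η ≤ 1) : ∃ y, mem y b ∧ dist x y < η := by
  have hpos : 0 < η := dist_nonneg.trans_lt hab
  have h := hM.h_extensional a b
  have h1 : edist a b < ENNReal.ofReal η := by
    rw [edist_dist]; exact (ENNReal.ofReal_lt_ofReal_iff hpos).2 hab
  rw [h, min_lt_iff] at h1
  rcases h1 with h1 | h1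
  · exact absurd h1 (not_lt.2 (by simpa using ENNReal.ofReal_le_ofReal hη))
  · obtain ⟨y, hy, hxy⟩ := Metric.exists_edist_lt_of_hausdorffEDist_lt (s := {x | mem x a}) hx h1
    rw [edist_dist] at hxy
    exact ⟨y, hy, (ENNReal.ofReal_lt_ofReal_iff hpos).1 hxy⟩

theorem dist_le_of_forall (hM : IsMetricSetStructure mem) {a b : M} {η : ℝ} (hη : 0 ≤ η)
    (h1 : ∀ x, mem x a → ∃ y, mem y b ∧ dist x y ≤ η)
    (h2 : ∀ x, mem x b → ∃ y, mem y a ∧ dist x y ≤ η) : dist a b ≤ η := by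
  have h : edist a b ≤ ENNReal.ofReal η := by
    rw [hM.h_extensional]
    refine (min_le_right _ _).trans (Metric.hausdorffEDist_le_of_mem_edist ?_ ?_)
    · intro x hx
      obtain ⟨y, hy, hxy⟩ := h1 x hx
      exact ⟨y, hy, by rw [edist_dist]; exact ENNReal.ofReal_le_ofReal hxy⟩
    · intro x hx
      obtain ⟨y, hy, hxy⟩ := h2 x hx
      exact ⟨y, hy, by rw [edist_dist]; exact ENNReal.ofReal_le_ofReal hxy⟩
  rw [edist_dist] at h
  exact (ENNReal.ofReal_le_ofReal_iff hη).1 h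

theorem ext (hM : IsMetricSetStructure mem) {a b : M} (h : ∀ x, mem x a ↔ mem x b) : a = b :=
  dist_le_zero.1 <| hM.dist_le_of_forall le_rfl
    (fun x hx => ⟨x, (h x).1 hx, by simp⟩) (fun x hx => ⟨x, (h x).2 hx, by simp⟩)

theorem isClosed_setOf_mem (hM : IsMetricSetStructure mem) (a : M) : IsClosed {x | mem x a} :=
  hM.closed.preimage (f := fun x : M => (x, a)) (by fun_prop)

theorem exists_dist_lt_of_mem_of_dist_lt_one (hM : IsMetricSetStructure mem) {a b x : M}
    {δ η : ℝ} (hx : mem x a) (hab : dist a b ≤ δ) (hδ : δ < 1) (hη : δ < η) :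
    ∃ y, mem y b ∧ dist x y < η := by
  obtain ⟨y, hy, hxy⟩ := hM.exists_dist_lt hx (hab.trans_lt (lt_min hη hδ)) (min_le_right _ _)
  exact ⟨y, hy, hxy.trans_le (min_le_left _ _)⟩

theorem abs_eval_le (hM : IsMetricSetStructure mem) :
    ∀ {n : ℕ} (φ : Formula n) (a : Fin n → M), |φ.eval mem a| ≤ φ.v
  | _, .one, _ => by simp [Formula.eval, Formula.v]
  | _, .dist x y, a => by
      simpa [Formula.eval, Formula.v] using hM.dist_le_one _ _
  | _, .plus φ ψ, a =>
      (abs_add_le _ _).trans (add_le_add (abs_eval_le hM φ a) (abs_eval_le hM ψ a))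
  | _, .max φ ψ, a => by
      have h1 := abs_le.1 (abs_eval_le hM φ a)
      have h2 := abs_le.1 (abs_eval_le hM ψ a)
      refine abs_le.2 ⟨?_, max_le_max h1.2 h2.2⟩
      exact (neg_le_neg (le_max_left _ _)).trans (h1.1.trans (le_max_left _ _))
  | _, .min φ ψ, a => by
      have h1 := abs_le.1 (abs_eval_le hM φ a)
      have h2 := abs_le.1 (abs_eval_le hM ψ a)
      refine abs_le.2 ⟨le_min ?_ ?_, (min_le_left _ _).trans (h1.2.trans (le_max_left _ _))⟩
      · exact (neg_le_neg (le_max_left _ _)).trans h1.1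
      · exact (neg_le_neg (le_max_right _ _)).trans h2.1
  | _, .smul r φ, a => by
      simp only [Formula.eval, Formula.v, abs_mul]
      exact mul_le_mul_of_nonneg_left (abs_eval_le hM φ a) (abs_nonneg r)
  | _, .sup φ, a => by
      have h (b : M) := abs_le.1 (abs_eval_le hM φ (Matrix.vecCons b a))
      rcases isEmpty_or_nonempty M with hE | ⟨⟨b⟩⟩
      · simpa [Formula.eval, Formula.v] using φ.v_nonneg
      · have : Nonempty M := ⟨b⟩
        refine abs_le.2 ⟨(h b).1.trans (le_ciSup (f := fun b => φ.eval mem (Matrix.vecCons b a))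
          ⟨φ.v, ?_⟩ b), ciSup_le fun b => (h b).2⟩
        rintro _ ⟨b, rfl⟩; exact (h b).2
  | _, .inf φ, a => by
      have h (b : M) := abs_le.1 (abs_eval_le hM φ (Matrix.vecCons b a))
      rcases isEmpty_or_nonempty M with hE | ⟨⟨b⟩⟩
      · simpa [Formula.eval, Formula.v] using φ.v_nonneg
      · have : Nonempty M := ⟨b⟩
        refine abs_le.2 ⟨le_ciInf fun b => (h b).1,
          (ciInf_le (f := fun b => φ.eval mem (Matrix.vecCons b a)) ⟨-φ.v, ?_⟩ b).trans (h b).2⟩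
        rintro _ ⟨b, rfl⟩; exact (h b).1
  | _, .bsup y φ, a => by
      have h (b : M) := abs_le.1 (abs_eval_le hM φ (Matrix.vecCons b a))
      simp only [Formula.eval, Formula.v]
      split_ifs with hy
      · obtain ⟨b, hb⟩ := hy
        have : Nonempty {c : M // mem c (a y)} := ⟨⟨b, hb⟩⟩
        refine abs_le.2 ⟨(h b).1.trans (le_ciSup
          (f := fun b : {c : M // mem c (a y)} => φ.eval mem (Matrix.vecCons b.1 a))
          ⟨φ.v, ?_⟩ ⟨b, hb⟩), ciSup_le fun b => (h b).2⟩
        rintro _ ⟨b, rfl⟩; exact (h b).2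
      · rw [abs_neg, abs_of_nonneg φ.v_nonneg]
  | _, .binf y φ, a => by
      have h (b : M) := abs_le.1 (abs_eval_le hM φ (Matrix.vecCons b a))
      simp only [Formula.eval, Formula.v]
      split_ifs with hy
      · obtain ⟨b, hb⟩ := hy
        have : Nonempty {c : M // mem c (a y)} := ⟨⟨b, hb⟩⟩
        refine abs_le.2 ⟨le_ciInf fun b => (h b).1, (ciInf_le
          (f := fun b : {c : M // mem c (a y)} => φ.eval mem (Matrix.vecCons b.1 a))
          ⟨-φ.v, ?_⟩ ⟨b, hb⟩).trans (h b).2⟩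
        rintro _ ⟨b, rfl⟩; exact (h b).1
      · rw [abs_of_nonneg φ.v_nonneg]

variable {n : ℕ}

theorem eval_le_v (hM : IsMetricSetStructure mem) (φ : Formula n) (a : Fin n → M) :
    φ.eval mem a ≤ φ.v := (abs_le.1 (hM.abs_eval_le φ a)).2

theorem neg_v_le_eval (hM : IsMetricSetStructure mem) (φ : Formula n) (a : Fin n → M) :
    -φ.v ≤ φ.eval mem a := (abs_le.1 (hM.abs_eval_le φ a)).1

theorem eval_sup_le_iff (hM : IsMetricSetStructure mem) [Nonempty M] {φ : Formula (n + 1)}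
    {a : Fin n → M} {t : ℝ} :
    (Formula.sup φ).eval mem a ≤ t ↔ ∀ b, φ.eval mem (Matrix.vecCons b a) ≤ t :=
  ciSup_le_iff ⟨φ.v, by rintro _ ⟨b, rfl⟩; exact hM.eval_le_v _ _⟩

theorem le_eval_inf_iff (hM : IsMetricSetStructure mem) [Nonempty M] {φ : Formula (n + 1)}
    {a : Fin n → M} {t : ℝ} :
    t ≤ (Formula.inf φ).eval mem a ↔ ∀ b, t ≤ φ.eval mem (Matrix.vecCons b a) :=
  le_ciInf_iff ⟨-φ.v, by rintro _ ⟨b, rfl⟩; exact hM.neg_v_le_eval _ _⟩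

theorem eval_bsup_le_iff (hM : IsMetricSetStructure mem) {φ : Formula (n + 1)} {y : Fin n}
    {a : Fin n → M} {t : ℝ} : (Formula.bsup y φ).eval mem a ≤ t ↔
      -φ.v ≤ t ∧ ∀ b, mem b (a y) → φ.eval mem (Matrix.vecCons b a) ≤ t := by
  simp only [Formula.eval]
  split_ifs with hy
  · have : Nonempty {c : M // mem c (a y)} := nonempty_subtype.2 hy
    rw [ciSup_le_iff ⟨φ.v, by rintro _ ⟨b, rfl⟩; exact hM.eval_le_v _ _⟩]
    obtain ⟨b, hb⟩ := hy
    exact ⟨fun h => ⟨(hM.neg_v_le_eval _ _).trans (h ⟨b, hb⟩), fun c hc => h ⟨c, hc⟩⟩,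
      fun h c => h.2 c.1 c.2⟩
  · exact ⟨fun h => ⟨h, fun b hb => absurd ⟨b, hb⟩ hy⟩, fun h => h.1⟩

theorem le_eval_binf_iff (hM : IsMetricSetStructure mem) {φ : Formula (n + 1)} {y : Fin n}
    {a : Fin n → M} {t : ℝ} : t ≤ (Formula.binf y φ).eval mem a ↔
      t ≤ φ.v ∧ ∀ b, mem b (a y) → t ≤ φ.eval mem (Matrix.vecCons b a) := by
  simp only [Formula.eval]
  split_ifs with hy
  · have : Nonempty {c : M // mem c (a y)} := nonempty_subtype.2 hy
    rw [le_ciInf_iff ⟨-φ.v, by rintro _ ⟨b, rfl⟩; exact hM.neg_v_le_eval _ _⟩]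
    obtain ⟨b, hb⟩ := hy
    exact ⟨fun h => ⟨(h ⟨b, hb⟩).trans (hM.eval_le_v _ _), fun c hc => h ⟨c, hc⟩⟩,
      fun h c => h.2 c.1 c.2⟩
  · exact ⟨fun h => ⟨h, fun b hb => absurd ⟨b, hb⟩ hy⟩, fun h => h.1⟩

/-- Formulas are Lipschitz with constant `2 v(φ)` for the supremum distance of assignments. -/
theorem eval_le_eval_add (hM : IsMetricSetStructure mem) [Nonempty M] :
    ∀ {n : ℕ} (φ : Formula n) {a b : Fin n → M} {δ : ℝ}, 0 ≤ δ → (∀ i, dist (a i) (b i) ≤ δ) →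
      φ.eval mem a ≤ φ.eval mem b + 2 * φ.v * δ
  | _, .one, _, _, δ, hδ, _ => by simp [Formula.eval, Formula.v]; linarith
  | _, .dist x y, a, b, δ, hδ, h => by
      simp only [Formula.eval, Formula.v]
      have h1 := dist_triangle4 (a x) (b x) (b y) (a y)
      have h2 := h x
      have h3 := h y
      rw [dist_comm] at h3
      linarith
  | _, .plus φ ψ, a, b, δ, hδ, h => by
      have h1 := eval_le_eval_add hM φ hδ h
      have h2 := eval_le_eval_add hM ψ hδ h
      simp only [Formula.eval, Formula.v]
      linarith
  | _, .max φ ψ, a, b, δ, hδ, h => by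
      have h1 := eval_le_eval_add hM φ hδ h
      have h2 := eval_le_eval_add hM ψ hδ h
      simp only [Formula.eval, Formula.v]
      have h3 := mul_le_mul_of_nonneg_right (le_max_left φ.v ψ.v) hδ
      have h4 := mul_le_mul_of_nonneg_right (le_max_right φ.v ψ.v) hδ
      refine max_le ?_ ?_
      · linarith [le_max_left (φ.eval mem b) (ψ.eval mem b)]
      · linarith [le_max_right (φ.eval mem b) (ψ.eval mem b)]
  | _, .min φ ψ, a, b, δ, hδ, h => by
      have h1 := eval_le_eval_add hM φ hδ h
      have h2 := eval_le_eval_add hM ψ hδ h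
      simp only [Formula.eval, Formula.v]
      have h3 := mul_le_mul_of_nonneg_right (le_max_left φ.v ψ.v) hδ
      have h4 := mul_le_mul_of_nonneg_right (le_max_right φ.v ψ.v) hδ
      rw [← sub_le_iff_le_add]
      refine le_min ?_ ?_
      · linarith [min_le_left (φ.eval mem a) (ψ.eval mem a)]
      · linarith [min_le_right (φ.eval mem a) (ψ.eval mem a)]
  | _, .smul r φ, a, b, δ, hδ, h => by
      have h1 := eval_le_eval_add hM φ hδ h
      have h2 := eval_le_eval_add hM φ hδ (fun i => (dist_comm (b i) (a i)).trans_le (h i))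
      simp only [Formula.eval, Formula.v]
      rcases le_total 0 r with hr | hr
      · rw [abs_of_nonneg hr]; nlinarith
      · rw [abs_of_nonpos hr]; nlinarith
  | _, .sup φ, a, b, δ, hδ, h => by
      refine hM.eval_sup_le_iff.2 fun c => ?_
      have h1 := eval_le_eval_add hM φ (a := Matrix.vecCons c a) (b := Matrix.vecCons c b) hδ
        (Fin.cases (by simpa using hδ) h)
      exact h1.trans (add_le_add_left (hM.eval_sup_le_iff.1 le_rfl c) _)
  | _, .inf φ, a, b, δ, hδ, h => by
      rw [← sub_le_iff_le_add]
      refine hM.le_eval_inf_iff.2 fun c => ?_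
      have h1 := eval_le_eval_add hM φ (a := Matrix.vecCons c a) (b := Matrix.vecCons c b) hδ
        (Fin.cases (by simpa using hδ) h)
      rw [sub_le_iff_le_add]
      exact (hM.le_eval_inf_iff.1 le_rfl c).trans h1
  | _, .bsup y φ, a, b, δ, hδ, h => by
      have hb := hM.neg_v_le_eval (Formula.bsup y φ) b
      simp only [Formula.v] at hb ⊢
      have hv := mul_nonneg φ.v_nonneg hδ
      -- For `δ < 1` an element of `a y` is matched with a nearby element of `b y`. For `δ ≥ 1` no
      -- matching is available, but `2vδ ≥ 2v` already exceeds the whole range `[-v, v]`.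
      rcases lt_or_ge δ 1 with h1 | h1
      · refine hM.eval_bsup_le_iff.2 ⟨by linarith, fun c hc => ?_⟩
        refine le_add_mul_of_forall_lt h1 fun η hη hη1 => ?_
        obtain ⟨d, hd, hcd⟩ := hM.exists_dist_lt_of_mem_of_dist_lt_one hc (h y) h1 hη
        have h2 := eval_le_eval_add hM φ (a := Matrix.vecCons c a) (b := Matrix.vecCons d b)
          (hδ.trans hη.le) (Fin.cases (by simpa using hcd.le) fun i => (h i).trans hη.le)
        have h3 := (hM.eval_bsup_le_iff.1 (le_refl ((Formula.bsup y φ).eval mem b))).2 d hd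
        linarith
      · have ha := hM.eval_le_v (Formula.bsup y φ) a
        simp only [Formula.v] at ha
        nlinarith [φ.v_nonneg]
  | _, .binf y φ, a, b, δ, hδ, h => by
      have ha := hM.eval_le_v (Formula.binf y φ) a
      simp only [Formula.v] at ha ⊢
      have hv := mul_nonneg φ.v_nonneg hδ
      rcases lt_or_ge δ 1 with h1 | h1
      · rw [← sub_le_iff_le_add]
        refine hM.le_eval_binf_iff.2 ⟨by linarith, fun c hc => ?_⟩
        rw [sub_le_iff_le_add]
        refine le_add_mul_of_forall_lt h1 fun η hη hη1 => ?_
        obtain ⟨d, hd, hcd⟩ := hM.exists_dist_lt_of_mem_of_dist_lt_one hc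
          ((dist_comm (b y) (a y)).trans_le (h y)) h1 hη
        have h2 := eval_le_eval_add hM φ (a := Matrix.vecCons d a) (b := Matrix.vecCons c b)
          (hδ.trans hη.le) (Fin.cases (by simpa [dist_comm] using hcd.le)
            fun i => (h i).trans hη.le)
        have h3 := (hM.le_eval_binf_iff.1 (le_refl ((Formula.binf y φ).eval mem a))).2 d hd
        linarith
      · have hb := hM.neg_v_le_eval (Formula.binf y φ) b
        simp only [Formula.v] at hb
        nlinarith [φ.v_nonneg]

/-- A closed set that is approximated from above by extensions is an extension. -/
theorem exists_of_approx (hM : IsMetricSetStructure mem) {C : Set M} (hC : IsClosed C)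
    (h : ∀ η : ℝ, 0 < η → ∃ b, (∀ c ∈ C, mem c b) ∧ ∀ x, mem x b → ∃ y ∈ C, dist x y < η) :
    ∃ b, ∀ x, mem x b ↔ x ∈ C := by
  have := hM.complete
  have hpos (k : ℕ) : (0 : ℝ) < (1 / 2) ^ k := by positivity
  -- Each `u k` contains `C` and lies within `2⁻ᵏ` of it, so the `u k` form a Cauchy sequence. Its
  -- limit has extension `C`: one inclusion uses that `C` is closed, the other that extensions are
  -- closed.
  choose u hu1 hu2 using fun k : ℕ => h ((1 / 2) ^ k) (hpos k)
  have hanti {N k : ℕ} (hk : N ≤ k) : (1 / 2 : ℝ) ^ k ≤ (1 / 2) ^ N :=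
    pow_le_pow_of_le_one (by norm_num) (by norm_num) hk
  have htend : Filter.Tendsto (fun k : ℕ => (1 / 2 : ℝ) ^ k) Filter.atTop (nhds 0) :=
    tendsto_pow_atTop_nhds_zero_of_lt_one (by norm_num) (by norm_num)
  have key (N k l : ℕ) (hk : N ≤ k) (x : M) (hx : mem x (u k)) :
      ∃ y, mem y (u l) ∧ dist x y ≤ (1 / 2) ^ N := by
    obtain ⟨y, hy, hxy⟩ := hu2 k x hx
    exact ⟨y, hu1 l y hy, hxy.le.trans (hanti hk)⟩
  have hcau : CauchySeq u := cauchySeq_of_le_tendsto_0 (fun N => (1 / 2 : ℝ) ^ N)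
    (fun k l N hk hl => hM.dist_le_of_forall (hpos N).le (key N k l hk) (key N l k hl)) htend
  obtain ⟨b, hb⟩ := cauchySeq_tendsto_of_complete hcau
  rw [Metric.tendsto_atTop] at hb
  refine ⟨b, fun x => ⟨fun hx => ?_, fun hx => ?_⟩⟩
  · rw [← hC.closure_eq, Metric.mem_closure_iff]
    intro η hη
    obtain ⟨N, hN⟩ := hb (min (η / 2) 1) (by positivity)
    obtain ⟨N', hN'⟩ := exists_pow_lt_of_lt_one (half_pos hη) (by norm_num : (1 / 2 : ℝ) < 1)
    have h1 := hN (max N N') (le_max_left _ _)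
    rw [dist_comm] at h1
    obtain ⟨y, hy, hxy⟩ := hM.exists_dist_lt hx h1 (min_le_right _ _)
    obtain ⟨z, hz, hyz⟩ := hu2 _ y hy
    refine ⟨z, hz, (dist_triangle x y z).trans_lt ?_⟩
    have := hanti (le_max_right N N')
    have := min_le_left (η / 2) 1
    linarith
  · have hcl := hM.isClosed_setOf_mem b
    change x ∈ {x | mem x b}
    rw [← hcl.closure_eq, Metric.mem_closure_iff]
    intro η hη
    obtain ⟨N, hN⟩ := hb (min η 1) (by positivity)
    obtain ⟨y, hy, hxy⟩ := hM.exists_dist_lt (hu1 N x hx) (hN N le_rfl) (min_le_right _ _)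
    exact ⟨y, hy, hxy.trans_le (min_le_left _ _)⟩

end IsMetricSetStructure

end MSE

namespace MSE

variable {M : Type*} [MetricSpace M] {mem : M → M → Prop}

/-! ### Distances to sets -/

/-- The distance from `w` to `C`, truncated at `1`. -/
noncomputable def dSet (w : M) (C : Set M) : ℝ := sInf (insert 1 (dist w '' C))

theorem le_dSet_iff {w : M} {C : Set M} {t : ℝ} :
    t ≤ dSet w C ↔ t ≤ 1 ∧ ∀ y ∈ C, t ≤ dist w y := by
  rw [dSet, le_csInf_iff _ (Set.insert_nonempty _ _)]
  · simp
  · refine ⟨0, ?_⟩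
    rintro _ (rfl | ⟨y, -, rfl⟩)
    exacts [zero_le_one, dist_nonneg]

theorem dSet_nonneg (w : M) (C : Set M) : 0 ≤ dSet w C :=
  le_dSet_iff.2 ⟨zero_le_one, fun _ _ => dist_nonneg⟩

theorem dSet_le_one (w : M) (C : Set M) : dSet w C ≤ 1 := (le_dSet_iff.1 le_rfl).1

theorem dSet_le_dist {w y : M} {C : Set M} (hy : y ∈ C) : dSet w C ≤ dist w y :=
  (le_dSet_iff.1 le_rfl).2 y hy

theorem dSet_eq_zero {w : M} {C : Set M} (hw : w ∈ C) : dSet w C = 0 :=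
  le_antisymm ((dSet_le_dist hw).trans_eq (dist_self w)) (dSet_nonneg w C)

theorem exists_dist_lt_of_dSet_lt {w : M} {C : Set M} {η : ℝ} (h : dSet w C < η) (hη : η ≤ 1) :
    ∃ y ∈ C, dist w y < η := by
  by_contra! hc
  exact h.not_ge (le_dSet_iff.2 ⟨hη, hc⟩)

theorem dSet_setOf_mem_eq_zero {w b : M} (hw : mem w b) : dSet w {c | mem c b} = 0 :=
  dSet_eq_zero (C := {c | mem c b}) hw

theorem dSet_setOf_mem_le_dist {w y b : M} (hy : mem y b) : dSet w {c | mem c b} ≤ dist w y :=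
  dSet_le_dist (C := {c | mem c b}) hy

theorem isClosed_of_forall_eq_or_le_dist {C : Set M} {δ : ℝ} (hδ : 0 < δ)
    (h : ∀ x ∈ C, ∀ y ∈ C, x = y ∨ δ ≤ dist x y) : IsClosed C :=
  Metric.isClosed_of_pairwise_le_dist hδ fun x hx y hy hxy => (h x hx y hy).resolve_left hxy

theorem IsMetricSetStructure.eval_e (hM : IsMetricSetStructure mem) {n : ℕ} (x y : Fin n)
    (a : Fin n → M) : (Formula.e x y).eval mem a = dSet (a x) {c | mem c (a y)} := by
  refine eq_of_forall_le_iff fun t => ?_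
  rw [Formula.e, hM.le_eval_binf_iff, le_dSet_iff]
  simp [Formula.v, Formula.eval]

/-! ### Renaming of variables -/

/-- Renaming of the free variables of a formula. -/
def Formula.rename : {n : ℕ} → Formula n → {m : ℕ} → (Fin n → Fin m) → Formula m
  | _, .one, _, _ => .one
  | _, .dist x y, _, g => .dist (g x) (g y)
  | _, .plus φ ψ, _, g => .plus (φ.rename g) (ψ.rename g)
  | _, .max φ ψ, _, g => .max (φ.rename g) (ψ.rename g)
  | _, .min φ ψ, _, g => .min (φ.rename g) (ψ.rename g)
  | _, .smul r φ, _, g => .smul r (φ.rename g)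
  | _, .sup φ, _, g => .sup (φ.rename (Fin.cases 0 fun i => (g i).succ))
  | _, .inf φ, _, g => .inf (φ.rename (Fin.cases 0 fun i => (g i).succ))
  | _, .bsup y φ, _, g => .bsup (g y) (φ.rename (Fin.cases 0 fun i => (g i).succ))
  | _, .binf y φ, _, g => .binf (g y) (φ.rename (Fin.cases 0 fun i => (g i).succ))

theorem Formula.v_rename : ∀ {n : ℕ} (φ : Formula n) {m : ℕ} (g : Fin n → Fin m),
    (φ.rename g).v = φ.v
  | _, .one, _, _ => rfl
  | _, .dist _ _, _, _ => rfl
  | _, .plus φ ψ, _, g => by simp [rename, v, φ.v_rename, ψ.v_rename]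
  | _, .max φ ψ, _, g => by simp [rename, v, φ.v_rename, ψ.v_rename]
  | _, .min φ ψ, _, g => by simp [rename, v, φ.v_rename, ψ.v_rename]
  | _, .smul _ φ, _, g => by simp [rename, v, φ.v_rename]
  | _, .sup φ, _, g => by simp [rename, v, φ.v_rename]
  | _, .inf φ, _, g => by simp [rename, v, φ.v_rename]
  | _, .bsup _ φ, _, g => by simp [rename, v, φ.v_rename]
  | _, .binf _ φ, _, g => by simp [rename, v, φ.v_rename]

theorem vecCons_comp_cases {M : Type*} {n m : ℕ} (b : M) (a : Fin m → M) (g : Fin n → Fin m) :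
    (fun i => Matrix.vecCons b a (Fin.cases 0 (fun i => (g i).succ) i)) =
      Matrix.vecCons b (fun i => a (g i)) := by
  funext i
  refine Fin.cases ?_ (fun j => ?_) i <;> simp

/-- Renaming serves to put two formulas with separate parameter tuples into one instance of
excision. -/
theorem Formula.eval_rename : ∀ {n : ℕ} (φ : Formula n) {m : ℕ} (g : Fin n → Fin m)
    (a : Fin m → M), (φ.rename g).eval mem a = φ.eval mem (fun i => a (g i))
  | _, .one, _, _, _ => rfl
  | _, .dist _ _, _, _, _ => rfl
  | _, .plus φ ψ, _, g, a => by simp [rename, eval, φ.eval_rename, ψ.eval_rename]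
  | _, .max φ ψ, _, g, a => by simp [rename, eval, φ.eval_rename, ψ.eval_rename]
  | _, .min φ ψ, _, g, a => by simp [rename, eval, φ.eval_rename, ψ.eval_rename]
  | _, .smul _ φ, _, g, a => by simp [rename, eval, φ.eval_rename]
  | _, .sup φ, _, g, a => by simp [rename, eval, φ.eval_rename, vecCons_comp_cases]
  | _, .inf φ, _, g, a => by simp [rename, eval, φ.eval_rename, vecCons_comp_cases]
  | _, .bsup y φ, _, g, a => by
      simp [rename, eval, φ.eval_rename, φ.v_rename, vecCons_comp_cases]
  | _, .binf y φ, _, g, a => by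
      simp [rename, eval, φ.eval_rename, φ.v_rename, vecCons_comp_cases]

/-! ### Definable functions and the existence of sets -/

/-- `f` is given by a formula with parameters. -/
def IsDef (mem : M → M → Prop) (f : M → ℝ) : Prop :=
  ∃ (n : ℕ) (φ : Formula (n + 1)) (a : Fin n → M),
    ∀ x, φ.eval mem (Matrix.vecCons x a) = f x

theorem IsMetricSetStructure.isDef_dSet (hM : IsMetricSetStructure mem) (b : M) :
    IsDef mem (fun x => dSet x {c | mem c b}) :=
  ⟨1, .e 0 1, ![b], fun _ => hM.eval_e _ _ _⟩

theorem IsDef.exists_lipschitz (hM : IsMetricSetStructure mem) {f : M → ℝ} (hf : IsDef mem f) :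
    ∃ L : ℝ, 0 < L ∧ ∀ x y, f x ≤ f y + L * dist x y := by
  obtain ⟨n, φ, a, h⟩ := hf
  refine ⟨2 * φ.v + 1, by linarith [φ.v_nonneg], fun x y => ?_⟩
  have : Nonempty M := ⟨x⟩
  have h1 := hM.eval_le_eval_add φ (a := Matrix.vecCons x a) (b := Matrix.vecCons y a)
    (δ := dist x y) dist_nonneg (Fin.cases le_rfl fun i => by simp [dist_nonneg])
  rw [h, h] at h1
  linarith [dist_nonneg (x := x) (y := y)]

namespace IsModel

theorem nonempty (hM : IsModel mem) : Nonempty M :=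
  (hM.excision 0 .one 0 1 one_pos ![]).nonempty

/-- Rescaling to `(f - r)/(s - r)` and `(g - r')/(s' - r')` gives both conditions the thresholds `0`
and `1`, so a single excision applied to the maximum handles them together. -/
theorem exists_excision (hM : IsModel mem) {f g : M → ℝ} (hf : IsDef mem f) (hg : IsDef mem g)
    {r s r' s' : ℝ} (hrs : r < s) (hrs' : r' < s') : ∃ b, ∀ x,
      (f x ≤ r → g x ≤ r' → mem x b) ∧ (mem x b → f x < s ∧ g x < s') := by
  obtain ⟨n, φ, a, hφ⟩ := hf
  obtain ⟨m, ψ, b, hψ⟩ := hg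
  obtain ⟨u, hu⟩ := hM.excision (n + m)
    (.max (.smul (1 / (s - r)) (.sub
        (φ.rename (Fin.cases 0 fun i => (Fin.castAdd m i).succ)) (.const r)))
      (.smul (1 / (s' - r')) (.sub
        (ψ.rename (Fin.cases 0 fun i => (Fin.natAdd n i).succ)) (.const r')))) 0 1
    one_pos (Fin.append a b)
  refine ⟨u, fun x => ?_⟩
  have h := hu x
  simp only [Formula.eval, Formula.sub, Formula.const, Formula.eval_rename, vecCons_comp_cases,
    Fin.append_left, Fin.append_right, hφ, hψ, max_le_iff, max_lt_iff] at h
  have h1 : 0 < s - r := sub_pos.2 hrs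
  have h2 : 0 < s' - r' := sub_pos.2 hrs'
  refine ⟨fun h3 h4 => h.1 ⟨?_, ?_⟩, fun h3 => ?_⟩
  · exact mul_nonpos_of_nonneg_of_nonpos (by positivity) (by linarith)
  · exact mul_nonpos_of_nonneg_of_nonpos (by positivity) (by linarith)
  · obtain ⟨h4, h5⟩ := h.2 h3
    rw [one_div, inv_mul_lt_one₀ (by assumption)] at h4 h5
    constructor <;> linarith

/-- Excision between `0` and a small `η` applied to the distance function gives a set containing `C`
inside the `η`-neighbourhood of `C`; completeness then produces `C` itself. -/
theorem exists_of_isDef (hM : IsModel mem) {C : Set M} (hC : IsClosed C)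
    (h : IsDef mem (fun x => dSet x C)) : ∃ b, ∀ x, mem x b ↔ x ∈ C := by
  refine hM.isMetricSetStructure.exists_of_approx hC fun η hη => ?_
  obtain ⟨b, hb⟩ := hM.exists_excision h h (lt_min hη one_pos) (lt_min hη one_pos)
  refine ⟨b, fun c hc => (hb c).1 (dSet_eq_zero hc).le (dSet_eq_zero hc).le, fun x hx => ?_⟩
  obtain ⟨y, hy, hxy⟩ := exists_dist_lt_of_dSet_lt ((hb x).2 hx).1 (min_le_right _ _)
  exact ⟨y, hy, hxy.trans_le (min_le_left _ _)⟩

/-- Excision relative to a discrete set. -/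
theorem exists_separation (hM : IsModel mem) {T : M} {δ : ℝ} (hδ : 0 < δ) (hδ1 : δ ≤ 1)
    (hT : IsDiscrete mem δ T) {f : M → ℝ} (hf : IsDef mem f) {r s : ℝ} (hrs : r < s) :
    ∃ c, (∀ y, mem y c → mem y T) ∧ ∀ y, mem y T → (f y ≤ r → mem y c) ∧ (mem y c → f y < s) := by
  obtain ⟨L, hL, hfL⟩ := hf.exists_lipschitz hM.isMetricSetStructure
  -- `η ≤ δ/5` keeps a chain of total length below `4η` from joining two distinct points of `T`. `L
  -- * η ≤ (s - r)/2` bounds the change of `f` when a point of `b` is moved to `T`.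
  obtain ⟨η, hη, hη1, hη2⟩ : ∃ η : ℝ, 0 < η ∧ η ≤ δ / 5 ∧ L * η ≤ (s - r) / 2 := by
    have : 0 < (s - r) / 2 := by linarith
    refine ⟨min (δ / 5) ((s - r) / 2 / L), by positivity, min_le_left _ _, ?_⟩
    rw [mul_comm, ← le_div_iff₀ hL]
    exact min_le_right _ _
  have hTdef := hM.isMetricSetStructure.isDef_dSet (mem := mem) T
  obtain ⟨b, hb⟩ := hM.exists_excision hf hTdef (show r < (r + s) / 2 by linarith) hη
  have hclosed : IsClosed {y | mem y T ∧ ∃ z, mem z b ∧ dist y z < η} :=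
    isClosed_of_forall_eq_or_le_dist hδ fun x hx y hy => hT x y hx.1 hy.1
  -- Excision gives only a set `b` of points near `T`; the wanted set collects the points of `T`
  -- close to `b`. Its distance function is not known to be definable, so it is approximated by sets
  -- of points near both `T` and `b`.
  obtain ⟨c, hc⟩ := hM.isMetricSetStructure.exists_of_approx hclosed fun θ hθ => by
    obtain ⟨u, hu⟩ := hM.exists_excision hTdef (hM.isMetricSetStructure.isDef_dSet b)
      (lt_min hθ hη) (show η < 2 * η by linarith)
    refine ⟨u, ?_, fun x hx => ?_⟩
    · rintro y ⟨hy, z, hz, hyz⟩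
      exact (hu y).1 (dSet_setOf_mem_eq_zero hy).le ((dSet_setOf_mem_le_dist hz).trans hyz.le)
    · obtain ⟨h1, h2⟩ := (hu x).2 hx
      obtain ⟨y, hy, hxy⟩ := exists_dist_lt_of_dSet_lt h1 ((min_le_right _ _).trans (by linarith))
      obtain ⟨z, hz, hxz⟩ := exists_dist_lt_of_dSet_lt h2 (by linarith)
      obtain ⟨t, ht, hzt⟩ := exists_dist_lt_of_dSet_lt ((hb z).2 hz).2 (by linarith)
      have h3 := min_le_right θ η
      have h4 : y = t := by
        refine (hT y t hy ht).resolve_right fun h => ?_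
        have := dist_triangle4 y x z t
        rw [dist_comm y x] at this
        linarith
      subst h4
      exact ⟨y, ⟨hy, z, hz, by rwa [dist_comm]⟩, hxy.trans_le (min_le_left _ _)⟩
  refine ⟨c, fun y hy => ((hc y).1 hy).1, fun y hy => ⟨fun hfy => (hc y).2 ⟨hy, y, ?_, ?_⟩, ?_⟩⟩
  · exact (hb y).1 hfy (dSet_setOf_mem_eq_zero hy).le
  · simpa using hη
  · intro hyc
    obtain ⟨-, z, hz, hyz⟩ := (hc y).1 hyc
    have h1 := hfL y z
    have h2 := ((hb z).2 hz).1
    nlinarith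

end IsModel

end MSE

namespace MSE

variable {M : Type*} [MetricSpace M] {mem : M → M → Prop} {n : ℕ}

/-! ### Distances to sets, pairs, and relativized quantifiers as formulas -/

theorem Formula.eval_abs (φ : Formula n) (a : Fin n → M) :
    (Formula.abs φ).eval mem a = |φ.eval mem a| := by
  simp [Formula.abs, Formula.eval, _root_.abs]

theorem Formula.eval_sub (φ ψ : Formula n) (a : Fin n → M) :
    (Formula.sub φ ψ).eval mem a = φ.eval mem a - ψ.eval mem a := by
  simp [Formula.sub, Formula.eval]; ring

theorem Formula.eval_const (r : ℝ) (a : Fin n → M) :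
    (Formula.const r : Formula n).eval mem a = r := by
  simp [Formula.const, Formula.eval]

namespace IsMetricSetStructure

theorem dSet_le_add_dist (hM : IsMetricSetStructure mem) (w a b : M) :
    dSet w {c | mem c a} ≤ dSet w {c | mem c b} + dist a b := by
  rw [← sub_le_iff_le_add]
  refine le_dSet_iff.2 ⟨by linarith [dSet_le_one w {c | mem c a}, dist_nonneg (x := a) (y := b)],
    fun y hy => ?_⟩
  rw [sub_le_iff_le_add, ← one_mul (dist a b)]
  rcases lt_or_ge (dist a b) 1 with h1 | h1
  · refine le_add_mul_of_forall_lt h1 fun η hη hη1 => ?_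
    obtain ⟨x, hx, hyx⟩ := hM.exists_dist_lt hy ((dist_comm b a).trans_lt hη) hη1.le
    have h2 : dSet w {c | mem c a} ≤ dist w x := dSet_le_dist hx
    linarith [dist_triangle w y x]
  · linarith [dSet_le_one w {c | mem c a}, dist_nonneg (x := w) (y := y)]

/-- Together with `dSet_le_add_dist` this yields `d(a, b) = sup_w |d(w, a) - d(w, b)|`, which is why
`distSet` can express the distance to a set that is not among the variables. -/
theorem dist_le_of_forall_dSet_le (hM : IsMetricSetStructure mem) {a b : M} {t : ℝ} (ht : 0 ≤ t)
    (h : ∀ w, |dSet w {c | mem c a} - dSet w {c | mem c b}| ≤ t) : dist a b ≤ t := by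
  rcases lt_or_ge t 1 with h1 | h1
  · rw [← zero_add t, ← one_mul t]
    refine le_add_mul_of_forall_lt h1 fun η hη hη1 => ?_
    rw [zero_add, one_mul]
    refine hM.dist_le_of_forall (ht.trans hη.le) (fun x hx => ?_) (fun x hx => ?_)
    · have h2 := (abs_le.1 (h x)).1
      rw [dSet_setOf_mem_eq_zero hx] at h2
      obtain ⟨y, hy, hxy⟩ := exists_dist_lt_of_dSet_lt (w := x) (C := {c | mem c b})
        (by linarith) hη1.le
      exact ⟨y, hy, hxy.le⟩
    · have h2 := (abs_le.1 (h x)).2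
      rw [dSet_setOf_mem_eq_zero hx] at h2
      obtain ⟨y, hy, hxy⟩ := exists_dist_lt_of_dSet_lt (w := x) (C := {c | mem c a})
        (by linarith) hη1.le
      exact ⟨y, hy, hxy.le⟩
  · exact (hM.dist_le_one a b).trans h1

theorem eval_distSet (hM : IsMetricSetStructure mem) {z : Fin n} {D : Formula (n + 1)}
    {a : Fin n → M} {b : M}
    (hD : ∀ w, D.eval mem (Matrix.vecCons w a) = dSet w {c | mem c b}) :
    (Formula.distSet z D).eval mem a = dist (a z) b := by
  have : Nonempty M := ⟨b⟩
  refine eq_of_forall_ge_iff fun t => ?_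
  rw [Formula.distSet, hM.eval_sup_le_iff]
  simp only [Formula.eval_abs, Formula.eval_sub, hM.eval_e, hD, Matrix.cons_val_zero,
    Matrix.cons_val_succ]
  refine ⟨fun h => hM.dist_le_of_forall_dSet_le ((abs_nonneg _).trans (h b)) h,
    fun h w => le_trans ?_ h⟩
  have h1 := hM.dSet_le_add_dist w (a z) b
  have h2 := hM.dSet_le_add_dist w b (a z)
  rw [dist_comm] at h2
  rw [abs_le]
  constructor <;> linarith

theorem dSet_singleton (hM : IsMetricSetStructure mem) (w x : M) : dSet w {x} = dist w x := by
  refine eq_of_forall_le_iff fun t => ?_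
  simp only [le_dSet_iff, Set.mem_singleton_iff, forall_eq]
  exact ⟨fun h => h.2, fun h => ⟨h.trans (hM.dist_le_one _ _), h⟩⟩

theorem dSet_pair (hM : IsMetricSetStructure mem) (w x y : M) :
    dSet w {x, y} = min (dist w x) (dist w y) := by
  refine eq_of_forall_le_iff fun t => ?_
  simp only [le_dSet_iff, Set.mem_insert_iff, Set.mem_singleton_iff, forall_eq_or_imp, forall_eq,
    le_min_iff]
  exact ⟨fun h => h.2, fun h => ⟨h.1.trans (hM.dist_le_one _ _), h⟩⟩

theorem eval_distSingleton (hM : IsMetricSetStructure mem) {z x : Fin n} {a : Fin n → M} {b : M}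
    (hb : {c | mem c b} = {a x}) : (Formula.distSingleton z x).eval mem a = dist (a z) b :=
  hM.eval_distSet fun w => by simp [Formula.eval, hb, hM.dSet_singleton]

theorem dist_eq_one_of_empty (hM : IsMetricSetStructure mem) {a b x : M} (hx : mem x a)
    (hb : ∀ c, ¬ mem c b) : dist a b = 1 := by
  refine (hM.dist_le_one a b).antisymm (not_lt.1 fun h => ?_)
  obtain ⟨y, hy, -⟩ := hM.exists_dist_lt hx h le_rfl
  exact hb y hy

theorem eval_distEmpty (hM : IsMetricSetStructure mem) {z : Fin n} {a : Fin n → M} {b : M}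
    (hb : {c | mem c b} = ∅) : (Formula.distEmpty z).eval mem a = dist (a z) b := by
  have hb' (c : M) : ¬ mem c b := fun h => (Set.ext_iff.1 hb c).1 h
  rw [Formula.distEmpty, Formula.eval_sub]
  simp only [Formula.eval, dist_self, Formula.v]
  -- The bounded infimum of `d(x, x)` detects emptiness: it is `0` over a nonempty set and takes its
  -- default `v = 1` over the empty one.
  split_ifs with h
  · have : Nonempty {c : M // mem c (a z)} := nonempty_subtype.2 h
    obtain ⟨x, hx⟩ := h
    rw [hM.dist_eq_one_of_empty hx hb', ciInf_const, sub_zero]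
  · push Not at h
    rw [hM.ext (a := a z) (b := b) fun x => iff_of_false (h x) (hb' x)]
    simp

theorem eval_distPair (hM : IsMetricSetStructure mem) {z x y : Fin n} {a : Fin n → M} {p : M}
    (hp : IsPair mem p (a x) (a y)) : (Formula.distPair z x y).eval mem a = dist (a z) p := by
  obtain ⟨sx, o, q, sy, t, hsx, ho, hq, hsy, ht, hp⟩ := hp
  refine hM.eval_distSet fun w => ?_
  rw [hp, hM.dSet_pair]
  simp only [Formula.eval]
  congr 1
  · refine hM.eval_distSet fun w' => ?_
    rw [hq, hM.dSet_pair]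
    simp only [Formula.eval]
    congr 1
    · exact hM.eval_distSingleton hsx
    · exact hM.eval_distEmpty ho
  · refine hM.eval_distSet fun w' => ?_
    rw [ht, hM.dSet_singleton]
    exact hM.eval_distSingleton hsy

/-- The empty set is at distance `1` from every nonempty set. So at distance below `1` the component
`{{x}, ∅}` cannot be matched with `{{y'}}`, nor `{x}` with `∅`, and the coordinates must match each
other. -/
theorem isPair_dist_lt (hM : IsMetricSetStructure mem) {p x y p' x' y' : M} {η : ℝ} (hη : η ≤ 1)
    (hp : IsPair mem p x y) (hp' : IsPair mem p' x' y') (h : dist p p' < η) :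
    dist x x' < η ∧ dist y y' < η := by
  obtain ⟨sx, o, q, sy, t, hsx, ho, hq, hsy, ht, hp⟩ := hp
  obtain ⟨sx', o', q', sy', t', hsx', ho', hq', hsy', ht', hp'⟩ := hp'
  simp only [Set.ext_iff, Set.mem_ofPred_eq, Set.mem_singleton_iff, Set.mem_insert_iff,
    Set.mem_empty_iff_false, iff_false] at *
  constructor
  · obtain ⟨u, hu, hqu⟩ := hM.exists_dist_lt ((hp q).2 (.inl rfl)) h hη
    rcases (hp' u).1 hu with rfl | rfl
    · obtain ⟨v, hv, hsv⟩ := hM.exists_dist_lt ((hq sx).2 (.inl rfl)) hqu hη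
      rcases (hq' v).1 hv with rfl | rfl
      · obtain ⟨w, hw, hxw⟩ := hM.exists_dist_lt ((hsx x).2 rfl) hsv hη
        rwa [(hsx' w).1 hw] at hxw
      · obtain ⟨w, hw, hxw⟩ := hM.exists_dist_lt ((hsx x).2 rfl) hsv hη
        exact absurd hw (ho' w)
    · obtain ⟨v, hv, hov⟩ := hM.exists_dist_lt ((hq o).2 (.inr rfl)) hqu hη
      rw [(ht' v).1 hv, dist_comm] at hov
      obtain ⟨w, hw, -⟩ := hM.exists_dist_lt ((hsy' y').2 rfl) hov hη
      exact absurd hw (ho w)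
  · obtain ⟨u, hu, htu⟩ := hM.exists_dist_lt ((hp t).2 (.inr rfl)) h hη
    rcases (hp' u).1 hu with rfl | rfl
    · rw [dist_comm] at htu
      obtain ⟨v, hv, hov⟩ := hM.exists_dist_lt ((hq' o').2 (.inr rfl)) htu hη
      rw [(ht v).1 hv, dist_comm] at hov
      obtain ⟨w, hw, -⟩ := hM.exists_dist_lt ((hsy y).2 rfl) hov hη
      exact absurd hw (ho' w)
    · obtain ⟨v, hv, hsv⟩ := hM.exists_dist_lt ((ht sy).2 rfl) htu hη
      rw [(ht' v).1 hv] at hsv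
      obtain ⟨w, hw, hyw⟩ := hM.exists_dist_lt ((hsy y).2 rfl) hsv hη
      rwa [(hsy' w).1 hw] at hyw

theorem isPair_inj (hM : IsMetricSetStructure mem) {p x y x' y' : M}
    (hp : IsPair mem p x y) (hp' : IsPair mem p x' y') : x = x' ∧ y = y' := by
  have key (η : ℝ) (hη : 0 < η) : dist x x' < η ∧ dist y y' < η := by
    obtain ⟨h1, h2⟩ := hM.isPair_dist_lt (η := min η 1) (min_le_right _ _) hp hp'
      (by rw [dist_self]; positivity)
    exact ⟨h1.trans_le (min_le_left _ _), h2.trans_le (min_le_left _ _)⟩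
  exact ⟨eq_of_forall_dist_le fun η hη => (key η hη).1.le,
    eq_of_forall_dist_le fun η hη => (key η hη).2.le⟩

theorem ext_setOf (hM : IsMetricSetStructure mem) {a b : M}
    (h : {c | mem c a} = {c | mem c b}) : a = b :=
  hM.ext fun x => Set.ext_iff.1 h x

theorem isPair_unique (hM : IsMetricSetStructure mem) {p p' x y : M}
    (hp : IsPair mem p x y) (hp' : IsPair mem p' x y) : p = p' := by
  obtain ⟨sx, o, q, sy, t, hsx, ho, hq, hsy, ht, hp⟩ := hp
  obtain ⟨sx', o', q', sy', t', hsx', ho', hq', hsy', ht', hp'⟩ := hp'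
  obtain rfl := hM.ext_setOf (hsx.trans hsx'.symm)
  obtain rfl := hM.ext_setOf (ho.trans ho'.symm)
  obtain rfl := hM.ext_setOf (hsy.trans hsy'.symm)
  obtain rfl := hM.ext_setOf (hq.trans hq'.symm)
  obtain rfl := hM.ext_setOf (ht.trans ht'.symm)
  exact hM.ext_setOf (hp.trans hp'.symm)

variable {D φ : Formula (n + 1)} {a : Fin n → M} {C : Set M} {t : ℝ}

theorem eval_vecCons_le (hM : IsMetricSetStructure mem) (φ : Formula (n + 1)) (a : Fin n → M)
    (x y : M) : φ.eval mem (Matrix.vecCons x a) ≤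
      φ.eval mem (Matrix.vecCons y a) + 2 * φ.v * dist x y := by
  have : Nonempty M := ⟨x⟩
  exact hM.eval_le_eval_add φ dist_nonneg (Fin.cases le_rfl fun i => by simp)

/-- At a point within distance less than `1` of `C`, the penalty `2v·D` compensates the Lipschitz
change on moving into `C`. At the remaining points it lifts the value from at least `-v` to at least
`v`. -/
theorem le_eval_infRel_iff (hM : IsMetricSetStructure mem) [Nonempty M]
    (hD : ∀ w, D.eval mem (Matrix.vecCons w a) = dSet w C) :
    t ≤ (Formula.infRel D φ).eval mem a ↔
      t ≤ φ.v ∧ ∀ x ∈ C, t ≤ φ.eval mem (Matrix.vecCons x a) := by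
  rw [Formula.infRel, hM.le_eval_inf_iff]
  simp only [Formula.eval, Formula.eval_const, hD, le_min_iff]
  refine ⟨fun h => ⟨(h (Classical.arbitrary M)).2, fun x hx => ?_⟩, fun h x => ⟨?_, h.1⟩⟩
  · simpa [dSet_eq_zero hx] using (h x).1
  · rcases lt_or_ge (dSet x C) 1 with h1 | h1
    · refine le_add_mul_of_forall_lt h1 fun η hη hη1 => ?_
      obtain ⟨y, hy, hxy⟩ := exists_dist_lt_of_dSet_lt hη hη1.le
      have h2 := hM.eval_vecCons_le φ a y x
      rw [dist_comm] at h2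
      have h3 := h.2 y hy
      nlinarith [φ.v_nonneg]
    · have h2 := hM.neg_v_le_eval φ (Matrix.vecCons x a)
      nlinarith [h.1, φ.v_nonneg]

theorem eval_supRel_le_iff (hM : IsMetricSetStructure mem) [Nonempty M]
    (hD : ∀ w, D.eval mem (Matrix.vecCons w a) = dSet w C) :
    (Formula.supRel D φ).eval mem a ≤ t ↔
      -φ.v ≤ t ∧ ∀ x ∈ C, φ.eval mem (Matrix.vecCons x a) ≤ t := by
  rw [Formula.supRel, hM.eval_sup_le_iff]
  simp only [Formula.eval, Formula.eval_const, Formula.eval_sub, hD, max_le_iff]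
  refine ⟨fun h => ⟨(h (Classical.arbitrary M)).2, fun x hx => ?_⟩, fun h x => ⟨?_, h.1⟩⟩
  · simpa [dSet_eq_zero hx] using (h x).1
  · rw [sub_le_iff_le_add]
    rcases lt_or_ge (dSet x C) 1 with h1 | h1
    · refine le_add_mul_of_forall_lt h1 fun η hη hη1 => ?_
      obtain ⟨y, hy, hxy⟩ := exists_dist_lt_of_dSet_lt hη hη1.le
      have h2 := hM.eval_vecCons_le φ a x y
      have h3 := h.2 y hy
      nlinarith [φ.v_nonneg]
    · have h2 := hM.eval_le_v φ (Matrix.vecCons x a)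
      nlinarith [h.1, φ.v_nonneg]

end IsMetricSetStructure

/-- Makes the condition `t ≤ v`, which comes from the default value over the empty set, automatic
for truncated distances `t ≤ 1`. -/
theorem Formula.one_le_v_distSet (z : Fin n) (D : Formula (n + 1)) :
    1 ≤ (Formula.distSet z D).v := by
  refine le_trans ?_ (le_max_left _ _)
  exact le_add_of_nonneg_right (mul_nonneg (abs_nonneg _) D.v_nonneg)

theorem Formula.v_le_v_infRel (D φ : Formula (n + 1)) : φ.v ≤ (Formula.infRel D φ).v := by
  refine le_trans ?_ (le_max_left _ _)
  exact le_add_of_nonneg_right (mul_nonneg (abs_nonneg _) D.v_nonneg)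

/-! ### Existence of finite sets and pairs -/

namespace IsModel

theorem exists_empty (hM : IsModel mem) : ∃ b, {c | mem c b} = ∅ := by
  obtain ⟨b, hb⟩ := hM.exists_of_isDef (C := ∅) isClosed_empty
    ⟨0, .one, ![], fun x => le_antisymm (le_dSet_iff.2 (by simp [Formula.eval])) (dSet_le_one _ _)⟩
  exact ⟨b, Set.ext hb⟩

theorem exists_doubleton (hM : IsModel mem) (x y : M) : ∃ b, {c | mem c b} = {x, y} := by
  obtain ⟨b, hb⟩ := hM.exists_of_isDef (C := {x, y}) (Set.toFinite _).isClosed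
    ⟨2, .min (.dist 0 1) (.dist 0 2), ![x, y], fun w => (hM.isMetricSetStructure.dSet_pair w x y).symm⟩
  exact ⟨b, Set.ext hb⟩

theorem exists_singleton (hM : IsModel mem) (x : M) : ∃ b, {c | mem c b} = {x} := by
  simpa using hM.exists_doubleton x x

theorem exists_isPair (hM : IsModel mem) (x y : M) : ∃ p, IsPair mem p x y := by
  obtain ⟨sx, hsx⟩ := hM.exists_singleton x
  obtain ⟨o, ho⟩ := hM.exists_empty
  obtain ⟨q, hq⟩ := hM.exists_doubleton sx o
  obtain ⟨sy, hsy⟩ := hM.exists_singleton y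
  obtain ⟨t, ht⟩ := hM.exists_singleton sy
  obtain ⟨p, hp⟩ := hM.exists_doubleton q t
  exact ⟨p, sx, o, q, sy, t, hsx, ho, hq, hsy, ht, hp⟩

end IsModel

/-! ### Types over discrete sets -/

/-- For pairs, closeness passes to the coordinates. For power sets, Hausdorff matching pairs each
element with one at distance below `δ`, which must be equal to it; `δ ≤ 1` makes matching available.
-/
theorem Ty.eq_or_le_dist (hM : IsMetricSetStructure mem) {k : ℕ} {A : Fin k → M} {δ : ℝ}
    (hδ1 : δ ≤ 1) (hA : ∀ i, IsDiscrete mem δ (A i)) :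
    ∀ (t : Ty k) {x y : M}, t.Mem mem A x → t.Mem mem A y → x = y ∨ δ ≤ dist x y
  | .base i, _, _, hx, hy => hA i _ _ hx hy
  | .prod s t, _, _, ⟨x, y, hx, hy, hp⟩, ⟨x', y', hx', hy', hp'⟩ => by
      refine or_iff_not_imp_right.2 fun h => ?_
      obtain ⟨h1, h2⟩ := hM.isPair_dist_lt hδ1 hp hp' (not_le.1 h)
      obtain rfl := (s.eq_or_le_dist hM hδ1 hA hx hx').resolve_right (not_le.2 h1)
      obtain rfl := (t.eq_or_le_dist hM hδ1 hA hy hy').resolve_right (not_le.2 h2)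
      exact hM.isPair_unique hp hp'
  | .pow t, u, w, hu, hw => by
      refine or_iff_not_imp_right.2 fun h => hM.ext fun x => ⟨fun hx => ?_, fun hx => ?_⟩
      · obtain ⟨y, hy, hxy⟩ := hM.exists_dist_lt hx (not_le.1 h) hδ1
        rwa [(t.eq_or_le_dist hM hδ1 hA (hu x hx) (hw y hy)).resolve_right (not_le.2 hxy)]
      · obtain ⟨y, hy, hxy⟩ := hM.exists_dist_lt hx ((dist_comm w u).trans_lt (not_le.1 h)) hδ1
        rwa [(t.eq_or_le_dist hM hδ1 hA (hw x hx) (hu y hy)).resolve_right (not_le.2 hxy)]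

/-- The power set case rests on this: the nearest subset of `T` to `w` consists of the points of `T`
near `w`, so the distance is the one-sided excess `sup_{u ⊑ w} d(u, T)`. Discreteness is what lets
excision provide such a subset. -/
theorem Ty.eval_distPred (hM : IsModel mem) {k : ℕ} {A : Fin k → M} {δ : ℝ} (hδ : 0 < δ)
    (hδ1 : δ ≤ 1) (hA : ∀ i, IsDiscrete mem δ (A i)) :
    ∀ (t : Ty k) {n : ℕ} (ι : Fin k → Fin n) (w : Fin n) (a : Fin n → M), (∀ i, a (ι i) = A i) →
      (t.distPred ι w).eval mem a = dSet (a w) {c | t.Mem mem A c}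
  | .base i, n, ι, w, a, ha => by
      simp only [Ty.distPred, hM.isMetricSetStructure.eval_e, ha, Ty.Mem]
  | .prod s t, n, ι, w, a, ha => by
      have hS := hM.isMetricSetStructure
      have := hM.nonempty
      refine eq_of_forall_le_iff fun r => ?_
      simp only [Ty.distPred]
      rw [Formula.eval, le_min_iff, hS.le_eval_infRel_iff (C := {c | s.Mem mem A c})
        fun w => s.eval_distPred hM hδ hδ1 hA _ _ _ (fun i => by simpa using ha i)]
      simp only [Set.mem_ofPred_eq]
      have hv := Formula.one_le_v_distSet (w.succ.succ) (.min
        (.distSet 0 (.min (.distSingleton 0 (1 : Fin (n + 2)).succ.succ) (.distEmpty 0)))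
        (.distSet 0 (.distSingleton 0 (0 : Fin (n + 2)).succ.succ)))
      change 1 ≤ (Formula.distPair w.succ.succ 1 0).v at hv
      have hv' := hv.trans (Formula.v_le_v_infRel
        (t.distPred (fun i => (ι i).succ.succ) 0) _)
      rw [le_dSet_iff]
      refine and_congr_right fun hr => ?_
      rw [Formula.eval] at hr
      rw [and_iff_right (hr.trans hv')]
      have key (x : M) : r ≤ (Formula.infRel (t.distPred (fun i => (ι i).succ.succ) 0)
          (.distPair w.succ.succ 1 0)).eval mem (Matrix.vecCons x a) ↔
          ∀ y, t.Mem mem A y → ∀ p, IsPair mem p x y → r ≤ dist (a w) p := by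
        rw [hS.le_eval_infRel_iff (C := {c | t.Mem mem A c})
          fun w => t.eval_distPred hM hδ hδ1 hA _ _ _ (fun i => by simpa using ha i),
          and_iff_right (hr.trans hv)]
        refine forall₂_congr fun y hy => ?_
        obtain ⟨p, hp⟩ := hM.exists_isPair x y
        rw [hS.eval_distPair (p := p) hp]
        refine ⟨fun h p' hp' => ?_, fun h => h p hp⟩
        rw [hS.isPair_unique hp' hp]
        exact h
      simp only [key]
      exact ⟨fun h p ⟨x, y, hx, hy, hp⟩ => h x hx y hy p hp,
        fun h x hx y hy p hp => h p ⟨x, y, hx, hy, hp⟩⟩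
  | .pow t, n, ι, w, a, ha => by
      have hS := hM.isMetricSetStructure
      obtain ⟨T, hT⟩ := hM.exists_of_isDef (C := {c | t.Mem mem A c})
        (isClosed_of_forall_eq_or_le_dist hδ fun x hx y hy => t.eq_or_le_dist hS hδ1 hA hx hy)
        ⟨k, t.distPred Fin.succ 0, A, fun x => t.eval_distPred hM hδ hδ1 hA _ _ _ fun i => by simp⟩
      -- Only `r ≥ 0` matters: the outer maximum with `0` absorbs the default `-v` for empty `a w`.
      have hb : ∀ {r : ℝ}, 0 ≤ r →
          ((Formula.bsup w (t.distPred (fun i => (ι i).succ) 0)).eval mem a ≤ r ↔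
            ∀ u, mem u (a w) → dSet u {c | t.Mem mem A c} ≤ r) := fun {r} hr => by
        rw [hS.eval_bsup_le_iff, and_iff_right ((neg_nonpos.2 (Formula.v_nonneg _)).trans hr)]
        refine forall₂_congr fun u _ => ?_
        rw [t.eval_distPred hM hδ hδ1 hA _ _ _ (fun i => by simpa using ha i)]
        rfl
      rw [Ty.distPred, Formula.eval, Formula.eval_const]
      set m := (Formula.bsup w (t.distPred (fun i => (ι i).succ) 0)).eval mem a
      refine le_antisymm (le_dSet_iff.2 ⟨?_, fun c hc => ?_⟩) ?_
      · exact max_le zero_le_one ((hb zero_le_one).2 fun u _ => dSet_le_one _ _)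
      · refine max_le dist_nonneg ((hb dist_nonneg).2 fun u hu => ?_)
        rw [← zero_add (dist (a w) c), ← one_mul (dist (a w) c)]
        rcases lt_or_ge (dist (a w) c) 1 with h1 | h1
        · refine le_add_mul_of_forall_lt h1 fun η hη hη1 => ?_
          obtain ⟨y, hy, huy⟩ := hS.exists_dist_lt hu hη hη1.le
          have h2 : dSet u {c | t.Mem mem A c} ≤ dist u y := dSet_le_dist (hc y hy)
          linarith
        · linarith [dSet_le_one u {c | t.Mem mem A c}]
      · rw [← zero_add (max 0 m), ← one_mul (max 0 m)]
        rcases lt_or_ge (max 0 m) 1 with h1 | h1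
        · refine le_add_mul_of_forall_lt h1 fun η hη hη1 => ?_
          obtain ⟨θ, hθ, hθη⟩ := exists_between hη
          have hθ0 : 0 ≤ θ := (le_max_left 0 m).trans hθ.le
          -- `c` contains every point of `T` within `θ` of `a w` and none at distance `η` or more,
          -- so it is within `η` of `a w` in both directions.
          obtain ⟨c, hcT, hc⟩ := hM.exists_separation hδ hδ1 (T := T)
            (fun x y hx hy => t.eq_or_le_dist hS hδ1 hA ((hT x).1 hx) ((hT y).1 hy))
            (hS.isDef_dSet (a w)) hθη
          have h2 : dSet (a w) {c | ∀ u, mem u c → t.Mem mem A u} ≤ dist (a w) c :=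
            dSet_le_dist fun u hu => (hT u).1 (hcT u hu)
          refine h2.trans ?_
          rw [zero_add, one_mul]
          refine hS.dist_le_of_forall (hθ0.trans hθη.le) (fun u hu => ?_) fun y hy => ?_
          · have h3 := (hb (le_max_left 0 m)).1 (le_max_right 0 m) u hu
            obtain ⟨y, hy, huy⟩ := exists_dist_lt_of_dSet_lt (h3.trans_lt hθ)
              (hθη.trans hη1).le
            refine ⟨y, (hc y ((hT y).2 hy)).1 ((dSet_setOf_mem_le_dist hu).trans ?_),
              (huy.trans hθη).le⟩
            rw [dist_comm]; exact huy.le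
          · obtain ⟨u, hu, hyu⟩ :=
              exists_dist_lt_of_dSet_lt ((hc y (hcT y hy)).2 hy) hη1.le
            exact ⟨u, hu, hyu.le⟩
        · linarith [dSet_le_one (a w) {c | t.pow.Mem mem A c}]

theorem Ty.exists_realization (hM : IsModel mem) {k : ℕ} {A : Fin k → M} {δ : ℝ} (hδ : 0 < δ)
    (hδ1 : δ ≤ 1) (hA : ∀ i, IsDiscrete mem δ (A i)) (t : Ty k) :
    ∃ T, ∀ x, mem x T ↔ t.Mem mem A x :=
  hM.exists_of_isDef (C := {c | t.Mem mem A c})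
    (isClosed_of_forall_eq_or_le_dist hδ fun _ hx _ hy =>
      t.eq_or_le_dist hM.isMetricSetStructure hδ1 hA hx hy)
    ⟨k, t.distPred Fin.succ 0, A, fun _ => t.eval_distPred hM hδ hδ1 hA _ _ _ fun i => by simp⟩

end MSE

namespace MSE

variable {M : Type*} [MetricSpace M] {mem : M → M → Prop}

/-! ### Discrete formulas over discrete sets -/

namespace DisFormula

/-- The two sides of every equation in the formula range over sets that are jointly `δ`-discrete. -/
def EqDiscrete (mem : M → M → Prop) {k : ℕ} (A : Fin k → M) (δ : ℝ) :
    {Γ : List (Ty k)} → DisFormula Γ → Prop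
  | _, @eq _ _ b c _ _ => ∀ x y, b.Mem mem A x → c.Mem mem A y → x = y ∨ δ ≤ dist x y
  | _, pair _ _ _ => True
  | _, .mem _ _ => True
  | _, and Φ Ψ => Φ.EqDiscrete mem A δ ∧ Ψ.EqDiscrete mem A δ
  | _, not Φ => Φ.EqDiscrete mem A δ
  | _, ex _ Φ => Φ.EqDiscrete mem A δ

/-- The two sides of every equation in the formula have the same type. -/
def EqHomogeneous {k : ℕ} : {Γ : List (Ty k)} → DisFormula Γ → Prop
  | _, @eq _ _ b c _ _ => b = c
  | _, pair _ _ _ => True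
  | _, .mem _ _ => True
  | _, and Φ Ψ => Φ.EqHomogeneous ∧ Ψ.EqHomogeneous
  | _, not Φ => Φ.EqHomogeneous
  | _, ex _ Φ => Φ.EqHomogeneous

theorem eqHomogeneous_infinite : infinite.EqHomogeneous := by
  simp [infinite, isCard, isNat, equinum, isInductive, isZero, isSucc, rel, all, imp, iff, or,
    EqHomogeneous]

variable {k : ℕ} {A : Fin k → M} {δ : ℝ}

/-- The weaker notion `EqDiscrete` is kept because `corr` equates an element of `f` with a subset of
`a`, which have different types. -/
theorem EqHomogeneous.eqDiscrete (hM : IsMetricSetStructure mem) (hδ1 : δ ≤ 1)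
    (hA : ∀ i, IsDiscrete mem δ (A i)) :
    ∀ {Γ : List (Ty k)} {Φ : DisFormula Γ}, Φ.EqHomogeneous → Φ.EqDiscrete mem A δ
  | _, @eq _ _ b c _ _, h => fun x y hx hy => by
      obtain rfl : b = c := h
      exact b.eq_or_le_dist hM hδ1 hA hx hy
  | _, pair _ _ _, _ => trivial
  | _, .mem _ _, _ => trivial
  | _, and _ _, h => ⟨h.1.eqDiscrete hM hδ1 hA, h.2.eqDiscrete hM hδ1 hA⟩
  | _, not Φ, h => EqHomogeneous.eqDiscrete (Φ := Φ) hM hδ1 hA h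
  | _, ex _ Φ, h => EqHomogeneous.eqDiscrete (Φ := Φ) hM hδ1 hA h

theorem truncation_bounds {ε d : ℝ} {P : Prop} (hε : 0 < ε) (h1 : P → d = 0)
    (h2 : ¬ P → ε ≤ d) :
    (P → 1 ≤ max (1 - 1 / ε * d) 0) ∧ (¬ P → max (1 - 1 / ε * d) 0 ≤ 0) := by
  refine ⟨fun h => by simp [h1 h], fun h => max_le ?_ le_rfl⟩
  rw [sub_nonpos, one_div, ← div_eq_inv_mul, one_le_div hε]
  exact h2 h

/-- On discrete sets, `⟦Φ⟧_ε` is at least `1` where `Φ` holds and at most `0` where it fails. -/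
theorem eval_toFormula (hM : IsModel mem) (hδ : 0 < δ) (hδ1 : δ ≤ 1)
    (hA : ∀ i, IsDiscrete mem δ (A i)) :
    ∀ {Γ : List (Ty k)} (Φ : DisFormula Γ), Φ.EqDiscrete mem A δ → ∀ {n : ℕ} (ι : Fin k → Fin n)
      (σ : Env Γ (Fin n)) (a : Fin n → M) (ρ : Env Γ M), (∀ i, a (ι i) = A i) →
      (∀ b x, a (σ b x) = ρ b x) → (∀ (b : Ty k) x, b.Mem mem A (ρ b x)) →
      (Φ.Sat mem A ρ → 1 ≤ (Φ.toFormula δ ι σ).eval mem a) ∧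
      (¬ Φ.Sat mem A ρ → (Φ.toFormula δ ι σ).eval mem a ≤ 0)
  | _, @eq _ _ b c x y, hΦ, n, ι, σ, a, ρ, hι, hσ, hρ => by
      simp only [toFormula, Sat, Formula.eval, Formula.eval_sub, Formula.eval_const, hσ]
      exact truncation_bounds hδ (fun h => by rw [h, dist_self])
        fun h => (hΦ _ _ (hρ b x) (hρ c y)).resolve_left h
  | _, @pair _ _ b c x y p, hΦ, n, ι, σ, a, ρ, hι, hσ, hρ => by
      obtain ⟨q, hq⟩ := hM.exists_isPair (ρ b x) (ρ c y)
      have hS := hM.isMetricSetStructure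
      have h1 := hS.eval_distPair (z := σ _ p) (x := σ _ x) (y := σ _ y) (a := a) (p := q)
        (by rwa [hσ, hσ])
      simp only [toFormula, Sat, Formula.eval, Formula.eval_sub, Formula.eval_const, h1, hσ]
      refine truncation_bounds hδ (fun h => by rw [hS.isPair_unique h hq, dist_self]) fun h =>
        ((b.prod c).eq_or_le_dist hS hδ1 hA (hρ _ p) ⟨_, _, hρ b x, hρ c y, hq⟩).resolve_left ?_
      rintro h2
      exact h (h2 ▸ hq)
  | _, @DisFormula.mem _ _ b x y, hΦ, n, ι, σ, a, ρ, hι, hσ, hρ => by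
      have hS := hM.isMetricSetStructure
      simp only [toFormula, Sat, Formula.eval, Formula.eval_sub, Formula.eval_const, hS.eval_e, hσ]
      refine truncation_bounds hδ dSet_setOf_mem_eq_zero fun h => le_dSet_iff.2 ⟨hδ1, fun u hu => ?_⟩
      refine (b.eq_or_le_dist hS hδ1 hA (hρ b x) (hρ _ y u hu)).resolve_left ?_
      rintro h2
      exact h (h2 ▸ hu)
  | _, and Φ Ψ, hΦ, n, ι, σ, a, ρ, hι, hσ, hρ => by
      have h1 := eval_toFormula hM hδ hδ1 hA Φ hΦ.1 ι σ a ρ hι hσ hρ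
      have h2 := eval_toFormula hM hδ hδ1 hA Ψ hΦ.2 ι σ a ρ hι hσ hρ
      simp only [toFormula, Sat, Formula.eval, not_and_or, min_le_iff, le_min_iff]
      exact ⟨fun h => ⟨h1.1 h.1, h2.1 h.2⟩, fun h => h.imp h1.2 h2.2⟩
  | _, not Φ, hΦ, n, ι, σ, a, ρ, hι, hσ, hρ => by
      have h1 := eval_toFormula hM hδ hδ1 hA Φ hΦ ι σ a ρ hι hσ hρ
      simp only [toFormula, Sat, Formula.eval, Formula.eval_sub, not_not]
      exact ⟨fun h => by linarith [h1.2 h], fun h => by linarith [h1.1 h]⟩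
  | _, ex b Φ, hΦ, n, ι, σ, a, ρ, hι, hσ, hρ => by
      have hS := hM.isMetricSetStructure
      have := hM.nonempty
      have key (c : M) (hc : b.Mem mem A c) := eval_toFormula hM hδ hδ1 hA Φ hΦ
        (fun i => (ι i).succ) (Env.cons 0 (fun c x => (σ c x).succ)) (Matrix.vecCons c a)
        (ρ.cons c) (fun i => by simpa using hι i)
        (fun d x => by cases x <;> simp [Env.cons, hσ])
        (fun d x => by cases x <;> simp [Env.cons, hc, hρ])
      have hD {t : ℝ} := hS.eval_supRel_le_iff (t := t)
        (φ := Φ.toFormula δ (fun i => (ι i).succ) (Env.cons 0 (fun c x => (σ c x).succ)))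
        fun w => b.eval_distPred hM hδ hδ1 hA (fun i => (ι i).succ) 0 (Matrix.vecCons w a)
          (fun i => by simpa using hι i)
      simp only [toFormula, Sat]
      constructor
      · rintro ⟨c, hc, h⟩
        exact ((key c hc).1 h).trans ((hD.1 le_rfl).2 c hc)
      · intro h
        -- Over an empty type the supremum is `-v` rather than `0`; hence the induction carries
        -- inequalities instead of the exact values `0` and `1`.
        refine hD.2 ⟨neg_nonpos.2 (Formula.v_nonneg _), fun c hc => (key c hc).2 fun h' => ?_⟩
        exact h ⟨c, hc, h'⟩

end DisFormula

/-- Lists a typed assignment as a finite tuple of parameters, the form in which formulas are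
evaluated. -/
theorem Env.exists_fin {M : Type*} {k : ℕ} (A : Fin k → M) : ∀ (Γ : List (Ty k)) (ρ : Env Γ M),
    ∃ (n : ℕ) (ι : Fin k → Fin n) (σ : Env Γ (Fin n)) (a : Fin n → M),
      (∀ i, a (ι i) = A i) ∧ ∀ b x, a (σ b x) = ρ b x
  | [], _ => ⟨k, id, Env.nil, A, fun _ => rfl, fun _ x => nomatch x⟩
  | b :: Γ, ρ => by
      obtain ⟨n, ι, σ, a, h1, h2⟩ := Env.exists_fin A Γ fun c x => ρ c x.s
      refine ⟨n + 1, fun i => (ι i).succ, Env.cons 0 (fun c x => (σ c x).succ),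
        Matrix.vecCons (ρ b .z) a, fun i => by simpa using h1 i, fun c x => ?_⟩
      cases x <;> simp [Env.cons, h2]

/-- Comprehension for discrete formulas over discrete sets. -/
theorem IsModel.exists_comprehension (hM : IsModel mem) {k : ℕ} {A : Fin k → M} {δ : ℝ}
    (hδ : 0 < δ) (hδ1 : δ ≤ 1) (hA : ∀ i, IsDiscrete mem δ (A i)) {Γ : List (Ty k)} {b : Ty k}
    {Φ : DisFormula (b :: Γ)} (hΦ : Φ.EqDiscrete mem A δ) {ρ : Env Γ M}
    (hρ : ∀ (c : Ty k) x, c.Mem mem A (ρ c x)) :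
    ∃ c, ∀ x, mem x c ↔ b.Mem mem A x ∧ Φ.Sat mem A (ρ.cons x) := by
  obtain ⟨n, ι, σ, a, h1, h2⟩ := Env.exists_fin A Γ ρ
  obtain ⟨T, hT⟩ := b.exists_realization hM hδ hδ1 hA
  have key (c : M) (hc : b.Mem mem A c) := Φ.eval_toFormula hM hδ hδ1 hA hΦ
    (fun i => (ι i).succ) (Env.cons 0 (fun c x => (σ c x).succ)) (Matrix.vecCons c a)
    (ρ.cons c) (fun i => by simpa using h1 i)
    (fun d x => by cases x <;> simp [Env.cons, h2])
    (fun d x => by cases x <;> simp [Env.cons, hc, hρ])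
  obtain ⟨c, hcT, hc⟩ := hM.exists_separation hδ hδ1 (T := T)
    (fun x y hx hy => b.eq_or_le_dist hM.isMetricSetStructure hδ1 hA ((hT x).1 hx) ((hT y).1 hy))
    -- `-⟦Φ⟧` is at most `-1` where `Φ` holds and at least `0` where it fails, so separation between
    -- `-1` and `0` is exact.
    ⟨n, .smul (-1) (Φ.toFormula δ (fun i => (ι i).succ) (Env.cons 0 (fun c x => (σ c x).succ))), a,
      fun _ => rfl⟩ (show (-1 : ℝ) < 0 by norm_num)
  refine ⟨c, fun x => ⟨fun hx => ?_, fun ⟨hx, hs⟩ => (hc x ((hT x).2 hx)).1 ?_⟩⟩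
  · have hxT := hcT x hx
    refine ⟨(hT x).1 hxT, ?_⟩
    by_contra h
    have h3 := (key x ((hT x).1 hxT)).2 h
    have h4 := (hc x hxT).2 hx
    simp only [Formula.eval] at h4
    linarith
  · have h3 := (key x hx).1 hs
    simp only [Formula.eval]
    linarith

/-! ### A discrete set and the set of its singletons -/

theorem DisFormula.sat_imp {M : Type*} {mem : M → M → Prop} {k : ℕ}
    {A : Fin k → M} {Γ : List (Ty k)} {Φ Ψ : DisFormula Γ}
    {ρ : Env Γ M} : (Φ.imp Ψ).Sat mem A ρ ↔ (Φ.Sat mem A ρ → Ψ.Sat mem A ρ) := by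
  simp [imp, Sat]

theorem DisFormula.sat_iff {M : Type*} {mem : M → M → Prop} {k : ℕ}
    {A : Fin k → M} {Γ : List (Ty k)} {Φ Ψ : DisFormula Γ}
    {ρ : Env Γ M} : (Φ.iff Ψ).Sat mem A ρ ↔ (Φ.Sat mem A ρ ↔ Ψ.Sat mem A ρ) := by
  simp [iff, Sat, sat_imp, iff_iff_implies_and_implies]

theorem DisFormula.sat_or {M : Type*} {mem : M → M → Prop} {k : ℕ}
    {A : Fin k → M} {Γ : List (Ty k)} {Φ Ψ : DisFormula Γ}
    {ρ : Env Γ M} : (Φ.or Ψ).Sat mem A ρ ↔ (Φ.Sat mem A ρ ∨ Ψ.Sat mem A ρ) := by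
  simp only [or, Sat]; tauto

theorem DisFormula.sat_all {M : Type*} {mem : M → M → Prop} {k : ℕ}
    {A : Fin k → M} {Γ : List (Ty k)} {b : Ty k}
    {Φ : DisFormula (b :: Γ)} {ρ : Env Γ M} :
    (DisFormula.all b Φ).Sat mem A ρ ↔ ∀ c, b.Mem mem A c → Φ.Sat mem A (ρ.cons c) := by
  simp [all, Sat]

/-- Renaming of type variables. -/
def Ty.map {k m : ℕ} (g : Fin k → Fin m) : Ty k → Ty m
  | .base i => .base (g i)
  | .prod s t => .prod (s.map g) (t.map g)
  | .pow t => .pow (t.map g)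

theorem Ty.mem_map {M : Type*} {mem : M → M → Prop} {k m : ℕ} (g : Fin k → Fin m) (A : Fin m → M) :
    ∀ (t : Ty k) (c : M), (t.map g).Mem mem A c ↔ t.Mem mem (fun i => A (g i)) c
  | .base _, _ => Iff.rfl
  | .prod s t, c => by simp only [map, Mem, s.mem_map g A, t.mem_map g A]
  | .pow t, c => by simp only [map, Mem, t.mem_map g A]

/-- The correspondence between the types over `a` and the types over `f` that is induced by the
membership relation between elements of `a` and elements of `f`. -/
def Corr (mem : M → M → Prop) (a f : M) : Ty 1 → M → M → Prop
  | .base _, x, y => mem x y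
  | .prod s t, p, q =>
      ∃ x, s.Mem mem (fun _ => a) x ∧ ∃ y, t.Mem mem (fun _ => a) y ∧
      ∃ x', s.Mem mem (fun _ => f) x' ∧ ∃ y', t.Mem mem (fun _ => f) y' ∧
        IsPair mem p x y ∧ IsPair mem q x' y' ∧ Corr mem a f s x x' ∧ Corr mem a f t y y'
  | .pow t, u, w => ∀ x, t.Mem mem (fun _ => a) x → ∀ y, t.Mem mem (fun _ => f) y →
      Corr mem a f t x y → (mem x u ↔ mem y w)

/-- `Corr` as a discrete formula. -/
def DisFormula.corr : (t : Ty 1) → {Γ : List (Ty 2)} → Var Γ (t.map fun _ => 0) →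
    Var Γ (t.map fun _ => 1) → DisFormula Γ
  | .base _, _, x, y => ex (.pow (.base 0)) (and (eq y.s .z) (.mem x.s .z))
  | .prod s t, _, p, q =>
      ex (s.map fun _ => 0) (ex (t.map fun _ => 0) (ex (s.map fun _ => 1) (ex (t.map fun _ => 1)
        (and (pair (.s (.s (.s .z))) (.s (.s .z)) p.s.s.s.s) (and (pair (.s .z) .z q.s.s.s.s)
          (and (corr s (.s (.s (.s .z))) (.s .z)) (corr t (.s (.s .z)) .z)))))))
  | .pow t, _, u, w =>
      all (t.map fun _ => 0) (all (t.map fun _ => 1)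
        (imp (corr t (.s .z) .z) (iff (.mem (.s .z) u.s.s) (.mem .z w.s.s))))

section Corr

variable {a f : M}

theorem DisFormula.sat_corr {M : Type*} {mem : M → M → Prop} {a f : M} (hf : ∀ y, mem y f → ∀ x, mem x y → mem x a) :
    ∀ (t : Ty 1) {Γ : List (Ty 2)} (x : Var Γ (t.map fun _ => 0)) (y : Var Γ (t.map fun _ => 1))
      (ρ : Env Γ M), (t.map fun _ => 1).Mem mem ![a, f] (ρ _ y) →
      ((corr t x y).Sat mem ![a, f] ρ ↔ Corr mem a f t (ρ _ x) (ρ _ y))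
  | .base _, _, x, y, ρ, hy => by
      simp only [corr, Sat, Corr, Env.cons]
      exact ⟨fun ⟨c, _, h1, h2⟩ => h1 ▸ h2, fun h => ⟨_, hf _ hy, rfl, h⟩⟩
  | .prod s t, _, p, q, ρ, hq => by
      simp only [corr, Sat, Corr, Env.cons, Ty.mem_map]
      refine exists_congr fun x => and_congr_right fun hx => exists_congr fun y =>
        and_congr_right fun hy => exists_congr fun x' => and_congr_right fun hx' =>
        exists_congr fun y' => and_congr_right fun hy' => and_congr_right fun h1 =>
        and_congr_right fun h2 => ?_
      rw [sat_corr hf s _ _ _ ((Ty.mem_map _ _ _ _).2 hx'),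
        sat_corr hf t _ _ _ ((Ty.mem_map _ _ _ _).2 hy')]
      rfl
  | .pow t, _, u, w, ρ, hw => by
      simp only [corr, sat_all, sat_imp, sat_iff, Sat, Corr, Env.cons, Ty.mem_map]
      refine forall₂_congr fun x hx => forall₂_congr fun y hy => ?_
      rw [sat_corr hf t _ _ _ ((Ty.mem_map _ _ _ _).2 hy)]
      rfl

/-- The only equations occur in the base clause. Typed membership needs a right-hand variable of
power type, so the element of `f` is first equated with a subset of `a`. -/
theorem DisFormula.eqDiscrete_corr {δ : ℝ} (h : ∀ x y, mem x f → (∀ u, mem u y → mem u a) →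
    x = y ∨ δ ≤ dist x y) : ∀ (t : Ty 1) {Γ : List (Ty 2)} (x : Var Γ (t.map fun _ => 0))
      (y : Var Γ (t.map fun _ => 1)), (corr t x y).EqDiscrete mem ![a, f] δ
  | .base _, _, _, _ => ⟨h, trivial⟩
  | .prod s t, _, _, _ =>
      ⟨trivial, trivial, eqDiscrete_corr h s _ _, eqDiscrete_corr h t _ _⟩
  | .pow t, _, _, _ => by
      simp [corr, all, imp, iff, EqDiscrete, eqDiscrete_corr h t]

/-- `Corr` is a bijection between the elements of `t` over `a` and the elements of `t` over `f`. -/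
structure CorrBijective (mem : M → M → Prop) (a f : M) (t : Ty 1) : Prop where
  exists_right : ∀ x, t.Mem mem (fun _ => a) x → ∃ y, t.Mem mem (fun _ => f) y ∧ Corr mem a f t x y
  exists_left : ∀ y, t.Mem mem (fun _ => f) y → ∃ x, t.Mem mem (fun _ => a) x ∧ Corr mem a f t x y
  left_unique : ∀ x x' y, t.Mem mem (fun _ => a) x → t.Mem mem (fun _ => a) x' →
    t.Mem mem (fun _ => f) y → Corr mem a f t x y → Corr mem a f t x' y → x = x'
  right_unique : ∀ x y y', t.Mem mem (fun _ => a) x → t.Mem mem (fun _ => f) y →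
    t.Mem mem (fun _ => f) y' → Corr mem a f t x y → Corr mem a f t x y' → y = y'

/-- By induction on types. The power set step needs images and preimages under `Corr` to be sets of
`M`; this is comprehension over the two type variables `a` and `f`, and the reason for writing
`Corr` as a discrete formula. -/
theorem IsModel.corrBijective (hM : IsModel mem) {δ : ℝ} (hδ : 0 < δ) (hδ1 : δ ≤ 1)
    (ha : IsDiscrete mem δ a)
    (hf : ∀ y, mem y f ↔ ∃ b, mem b a ∧ {c | mem c y} = {b}) :
    ∀ t : Ty 1, CorrBijective mem a f t
  | .base _ => by
      have hS := hM.isMetricSetStructure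
      constructor
      · intro x hx
        obtain ⟨y, hy⟩ := hM.exists_singleton x
        exact ⟨y, (hf y).2 ⟨x, hx, hy⟩, (Set.ext_iff.1 hy x).2 rfl⟩
      · intro y hy
        obtain ⟨x, hx, hxy⟩ := (hf y).1 hy
        exact ⟨x, hx, (Set.ext_iff.1 hxy x).2 rfl⟩
      · intro x x' y _ _ hy h h'
        obtain ⟨b, -, hb⟩ := (hf y).1 hy
        exact ((Set.ext_iff.1 hb x).1 h).trans ((Set.ext_iff.1 hb x').1 h').symm
      · intro x y y' _ hy hy' h h'
        obtain ⟨b, -, hb⟩ := (hf y).1 hy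
        obtain ⟨b', -, hb'⟩ := (hf y').1 hy'
        obtain rfl : x = b := (Set.ext_iff.1 hb x).1 h
        obtain rfl : x = b' := (Set.ext_iff.1 hb' x).1 h'
        exact hS.ext_setOf (hb.trans hb'.symm)
  | .prod s t => by
      have hS := hM.isMetricSetStructure
      have hs := hM.corrBijective hδ hδ1 ha hf s
      have ht := hM.corrBijective hδ hδ1 ha hf t
      constructor
      · rintro p ⟨x, y, hx, hy, hp⟩
        obtain ⟨x', hx', hxx'⟩ := hs.exists_right x hx
        obtain ⟨y', hy', hyy'⟩ := ht.exists_right y hy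
        obtain ⟨q, hq⟩ := hM.exists_isPair x' y'
        exact ⟨q, ⟨x', y', hx', hy', hq⟩, x, hx, y, hy, x', hx', y', hy', hp, hq, hxx', hyy'⟩
      · rintro q ⟨x', y', hx', hy', hq⟩
        obtain ⟨x, hx, hxx'⟩ := hs.exists_left x' hx'
        obtain ⟨y, hy, hyy'⟩ := ht.exists_left y' hy'
        obtain ⟨p, hp⟩ := hM.exists_isPair x y
        exact ⟨p, ⟨x, y, hx, hy, hp⟩, x, hx, y, hy, x', hx', y', hy', hp, hq, hxx', hyy'⟩
      · rintro p p' q - - - ⟨x, hx, y, hy, x', hx', y', hy', hp, hq, hxx', hyy'⟩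
          ⟨u, hu, w, hw, u', hu', w', hw', hp', hq', huu', hww'⟩
        obtain ⟨rfl, rfl⟩ := hS.isPair_inj hq hq'
        obtain rfl := hs.left_unique x u x' hx hu hx' hxx' huu'
        obtain rfl := ht.left_unique y w y' hy hw hy' hyy' hww'
        exact hS.isPair_unique hp hp'
      · rintro p q q' - - - ⟨x, hx, y, hy, x', hx', y', hy', hp, hq, hxx', hyy'⟩
          ⟨u, hu, w, hw, u', hu', w', hw', hp', hq', huu', hww'⟩
        obtain ⟨rfl, rfl⟩ := hS.isPair_inj hp hp'
        obtain rfl := hs.right_unique x x' u' hx hx' hu' hxx' huu'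
        obtain rfl := ht.right_unique y y' w' hy hy' hw' hyy' hww'
        exact hS.isPair_unique hq hq'
  | .pow t => by
      have hS := hM.isMetricSetStructure
      have ht := hM.corrBijective hδ hδ1 ha hf t
      have hsub : ∀ y, mem y f → ∀ x, mem x y → mem x a := by
        intro y hy x hx
        obtain ⟨b, hb, hby⟩ := (hf y).1 hy
        rwa [(Set.ext_iff.1 hby x).1 hx]
      have hpow (x y : M) (hx : ∀ u, mem u x → mem u a) (hy : ∀ u, mem u y → mem u a) :
          x = y ∨ δ ≤ dist x y :=
        Ty.eq_or_le_dist (A := fun _ : Fin 1 => a) hS hδ1 (fun _ => ha) (.pow (.base 0)) hx hy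
      have hA : ∀ i, IsDiscrete mem δ (![a, f] i) := by
        intro i
        fin_cases i
        · exact ha
        · exact fun x y hx hy => hpow x y (hsub x hx) (hsub y hy)
      have hdisc := fun x y hx hy => hpow x y (hsub x hx) hy
      constructor
      · intro u hu
        -- `w` is the image of `u` under the correspondence on `t`; in the opposite direction the
        -- preimage of `w` is used.
        obtain ⟨w, hw⟩ := hM.exists_comprehension hδ hδ1 hA (Γ := [(t.map fun _ => 0).pow])
          (b := t.map fun _ => 1)
          (Φ := .ex (t.map fun _ => 0) (.and (.mem .z (.s (.s .z))) (.corr t .z (.s .z))))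
          ⟨trivial, DisFormula.eqDiscrete_corr hdisc t _ _⟩ (ρ := Env.nil.cons u)
          (by rintro _ (_ | ⟨⟨⟩⟩); exact (Ty.mem_map _ _ t.pow _).2 hu)
        have hw' (y : M) : mem y w ↔ t.Mem mem (fun _ => f) y ∧
            ∃ x, t.Mem mem (fun _ => a) x ∧ mem x u ∧ Corr mem a f t x y := by
          rw [hw, Ty.mem_map]
          refine and_congr_right fun hy => exists_congr fun x => ?_
          rw [Ty.mem_map, DisFormula.Sat,
            DisFormula.sat_corr hsub t _ _ _ ((Ty.mem_map _ _ _ _).2 hy)]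
          rfl
        refine ⟨w, fun y hy => ((hw' y).1 hy).1, fun x hx y hy hxy => ?_⟩
        refine ⟨fun h => (hw' y).2 ⟨hy, x, hx, h, hxy⟩, fun h => ?_⟩
        obtain ⟨-, x', hx', hxu', hxy'⟩ := (hw' y).1 h
        rwa [ht.left_unique x x' y hx hx' hy hxy hxy']
      · intro w hw
        obtain ⟨u, hu⟩ := hM.exists_comprehension hδ hδ1 hA (Γ := [(t.map fun _ => 1).pow])
          (b := t.map fun _ => 0)
          (Φ := .ex (t.map fun _ => 1) (.and (.mem .z (.s (.s .z))) (.corr t (.s .z) .z)))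
          ⟨trivial, DisFormula.eqDiscrete_corr hdisc t _ _⟩ (ρ := Env.nil.cons w)
          (by rintro _ (_ | ⟨⟨⟩⟩); exact (Ty.mem_map _ _ t.pow _).2 hw)
        have hu' (x : M) : mem x u ↔ t.Mem mem (fun _ => a) x ∧
            ∃ y, t.Mem mem (fun _ => f) y ∧ mem y w ∧ Corr mem a f t x y := by
          rw [hu, Ty.mem_map]
          refine and_congr_right fun hx => exists_congr fun y => ?_
          rw [Ty.mem_map]
          refine and_congr_right fun hy => ?_
          rw [DisFormula.Sat, DisFormula.sat_corr hsub t _ _ _ ((Ty.mem_map _ _ _ _).2 hy)]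
          rfl
        refine ⟨u, fun x hx => ((hu' x).1 hx).1, fun x hx y hy hxy => ?_⟩
        refine ⟨fun h => ?_, fun h => (hu' x).2 ⟨hx, y, hy, h, hxy⟩⟩
        obtain ⟨-, y', hy', hyw', hxy'⟩ := (hu' x).1 h
        rwa [ht.right_unique x y y' hx hy hy' hxy hxy']
      · intro u u' w hu hu' hw h h'
        refine hS.ext fun x => ⟨fun hx => ?_, fun hx => ?_⟩
        · obtain ⟨y, hy, hxy⟩ := ht.exists_right x (hu x hx)
          exact (h' x (hu x hx) y hy hxy).2 ((h x (hu x hx) y hy hxy).1 hx)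
        · obtain ⟨y, hy, hxy⟩ := ht.exists_right x (hu' x hx)
          exact (h x (hu' x hx) y hy hxy).2 ((h' x (hu' x hx) y hy hxy).1 hx)
      · intro u w w' hu hw hw' h h'
        refine hS.ext fun y => ⟨fun hy => ?_, fun hy => ?_⟩
        · obtain ⟨x, hx, hxy⟩ := ht.exists_left y (hw y hy)
          exact (h' x hx y (hw y hy) hxy).1 ((h x hx y (hw y hy) hxy).2 hy)
        · obtain ⟨x, hx, hxy⟩ := ht.exists_left y (hw' y hy)
          exact (h x hx y (hw' y hy) hxy).1 ((h' x hx y (hw' y hy) hxy).2 hy)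

/-- The usual isomorphism argument. Equations must be homogeneous since `Corr` compares objects of
one type only. -/
theorem DisFormula.sat_congr (hM : IsMetricSetStructure mem)
    (h : ∀ t, CorrBijective mem a f t) :
    ∀ {Γ : List (Ty 1)} (Φ : DisFormula Γ), Φ.EqHomogeneous → ∀ (ρ ρ' : Env Γ M),
      (∀ (b : Ty 1) x, b.Mem mem (fun _ => a) (ρ b x)) → (∀ (b : Ty 1) x, b.Mem mem (fun _ => f) (ρ' b x)) →
      (∀ b x, Corr mem a f b (ρ b x) (ρ' b x)) →
      (Φ.Sat mem (fun _ => a) ρ ↔ Φ.Sat mem (fun _ => f) ρ')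
  | _, @eq _ _ b c x y, hΦ, ρ, ρ', hρ, hρ', hc => by
      obtain rfl : b = c := hΦ
      simp only [Sat]
      have h1 := hc b x
      have h2 := hc b y
      refine ⟨fun h3 => ?_, fun h3 => ?_⟩
      · rw [h3] at h1
        exact (h b).right_unique _ _ _ (hρ b y) (hρ' b x) (hρ' b y) h1 h2
      · rw [h3] at h1
        exact (h b).left_unique _ _ _ (hρ b x) (hρ b y) (hρ' b y) h1 h2
  | _, @pair _ _ b c x y p, _, ρ, ρ', hρ, hρ', hc => by
      simp only [Sat]
      obtain ⟨u, hu, w, hw, u', hu', w', hw', hp, hq, huu', hww'⟩ := hc _ p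
      refine ⟨fun h1 => ?_, fun h1 => ?_⟩
      · obtain ⟨h2, h3⟩ := hM.isPair_inj h1 hp
        rw [← h2] at huu'
        rw [← h3] at hww'
        rwa [(h b).right_unique _ _ _ (hρ b x) (hρ' b x) hu' (hc b x) huu',
          (h c).right_unique _ _ _ (hρ c y) (hρ' c y) hw' (hc c y) hww']
      · obtain ⟨h2, h3⟩ := hM.isPair_inj h1 hq
        rw [← h2] at huu'
        rw [← h3] at hww'
        rwa [(h b).left_unique _ _ _ (hρ b x) hu (hρ' b x) (hc b x) huu',
          (h c).left_unique _ _ _ (hρ c y) hw (hρ' c y) (hc c y) hww']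
  | _, @DisFormula.mem _ _ b x y, _, ρ, ρ', hρ, hρ', hc =>
      hc _ y _ (hρ _ x) _ (hρ' _ x) (hc _ x)
  | _, and Φ Ψ, hΦ, ρ, ρ', hρ, hρ', hc =>
      and_congr (sat_congr hM h Φ hΦ.1 ρ ρ' hρ hρ' hc) (sat_congr hM h Ψ hΦ.2 ρ ρ' hρ hρ' hc)
  | _, not Φ, hΦ, ρ, ρ', hρ, hρ', hc => not_congr (sat_congr hM h Φ hΦ ρ ρ' hρ hρ' hc)
  | _, ex b Φ, hΦ, ρ, ρ', hρ, hρ', hc => by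
      have key (c c' : M) (h1 : b.Mem mem (fun _ => a) c) (h2 : b.Mem mem (fun _ => f) c')
          (h3 : Corr mem a f b c c') :=
        sat_congr hM h Φ hΦ (ρ.cons c) (ρ'.cons c')
          (fun d x => by cases x <;> simp [Env.cons, h1, hρ])
          (fun d x => by cases x <;> simp [Env.cons, h2, hρ'])
          (fun d x => by cases x <;> simp [Env.cons, h3, hc])
      simp only [Sat]
      constructor
      · rintro ⟨c, h1, hs⟩
        obtain ⟨c', h2, h3⟩ := (h b).exists_right c h1
        exact ⟨c', h2, (key c c' h1 h2 h3).1 hs⟩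
      · rintro ⟨c', h2, hs⟩
        obtain ⟨c, h1, h3⟩ := (h b).exists_left c' h2
        exact ⟨c, h1, (key c c' h1 h2 h3).2 hs⟩

theorem isInf_iff_sat {M : Type*} {mem : M → M → Prop} (a : M) :
    IsInf mem a ↔ DisFormula.infinite.Sat mem (fun _ => a) Env.nil := by
  rw [IsInf, show ![a] = fun _ => a from funext fun i => by simp]

/-- A discrete set is infinite if and only if the set of its singletons is. -/
theorem IsModel.isInf_iff_isInf_singletons (hM : IsModel mem) {δ : ℝ} (hδ : 0 < δ) (hδ1 : δ ≤ 1)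
    (ha : IsDiscrete mem δ a) (hf : ∀ y, mem y f ↔ ∃ b, mem b a ∧ {c | mem c y} = {b}) :
    IsInf mem a ↔ IsInf mem f := by
  rw [isInf_iff_sat, isInf_iff_sat]
  exact DisFormula.sat_congr hM.isMetricSetStructure (hM.corrBijective hδ hδ1 ha hf) _
    DisFormula.eqHomogeneous_infinite _ _ (fun _ x => nomatch x) (fun _ x => nomatch x)
    (fun _ x => nomatch x)

end Corr

/-- If `a` is empty then `|a|_a = 0`, and if `a = {p}` then `|a|_a = succ_a(0)`, both consisting of
the subsets of `a` that contain `p`. Either way it lies in every inductive set. This refutes the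
right-hand side when `r > 3`. -/
theorem IsModel.not_isInf_of_subsingleton (hM : IsModel mem) {a : M}
    (ha : ∀ x y, mem x a → mem y a → x = y) : ¬ IsInf mem a := by
  have hS := hM.isMetricSetStructure
  rw [isInf_iff_sat]
  simp only [DisFormula.infinite, DisFormula.isCard, DisFormula.isNat, DisFormula.equinum,
    DisFormula.isInductive, DisFormula.isZero, DisFormula.isSucc, DisFormula.rel,
    DisFormula.sat_all, DisFormula.sat_imp, DisFormula.sat_iff, DisFormula.sat_or,
    DisFormula.Sat, Env.cons, Ty.Mem]
  rintro ⟨n, hn, ⟨w, hw, haw, hcard⟩, hnat⟩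
  refine hnat fun X hX ⟨⟨z, hz, hz0, hzX⟩, hsucc⟩ => ?_
  by_cases hp : ∃ p, mem p a
  · obtain ⟨p, hp⟩ := hp
    obtain ⟨m, hm, hms, hmX⟩ := hsucc z hz hzX
    have h1 (c : M) (hc : ∀ u, mem u c → mem u a) : mem c n ↔ mem p c := by
      rw [hcard c hc]
      constructor
      · rintro ⟨h, hh, h2, -, h4⟩
        obtain ⟨q, hq, ⟨r, -, hr, hrh⟩, -⟩ := h4 p hp (haw p hp)
        obtain ⟨x, hx, y, hy, -, hxc, -⟩ := h2 r (hh r hrh) hrh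
        rwa [ha p x hp hx]
      · intro hpc
        obtain ⟨r, hr⟩ := hM.exists_isPair p p
        obtain ⟨h, hh⟩ := hM.exists_singleton r
        have hh' (x : M) : mem x h ↔ x = r := Set.ext_iff.1 hh x
        refine ⟨h, fun u hu => ⟨p, p, hp, hp, (hh' u).1 hu ▸ hr⟩, fun u _ hu =>
          ⟨p, hp, p, hp, (hh' u).1 hu ▸ hr, hpc, haw p hp⟩, fun x hx _ => ?_, fun x hx _ => ?_⟩
        · obtain rfl := ha p x hp hx
          exact ⟨p, hp, ⟨r, ⟨p, p, hp, hp, hr⟩, hr, (hh' r).2 rfl⟩, fun y hy _ => ha y p hy hp⟩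
        · obtain rfl := ha p x hp hx
          exact ⟨p, hp, ⟨r, ⟨p, p, hp, hp, hr⟩, hr, (hh' r).2 rfl⟩, fun y hy _ => ha y p hy hp⟩
    have h2 (c : M) (hc : ∀ u, mem u c → mem u a) : mem c m ↔ mem p c := by
      rw [hms c hc]
      constructor
      · rintro ⟨g, -, -, -, x, hx, ⟨hxc, -⟩, -⟩
        rwa [ha p x hp hx]
      · intro hpc
        obtain ⟨o, ho⟩ := hM.exists_empty
        have ho' (x : M) : ¬ mem x o := fun hx => (Set.ext_iff.1 ho x).1 hx
        exact ⟨o, fun u hu => absurd hu (ho' u),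
          (hz0 o fun u hu => absurd hu (ho' u)).2 fun u _ => ho' u,
          fun u _ hu => absurd hu (ho' u), p, hp, ⟨hpc, ho' p⟩, fun y hy _ => ha y p hy hp⟩
    have hnm : n = m := hS.ext fun c =>
      ⟨fun hc => (h2 c (hn c hc)).2 ((h1 c (hn c hc)).1 hc),
        fun hc => (h1 c (hm c hc)).2 ((h2 c (hm c hc)).1 hc)⟩
    rw [hnm]
    -- The alternative `succ_a(0) = ∅` is excluded because `a` itself belongs to `succ_a(0)`.
    exact hmX.resolve_right fun h => h a (fun _ hu => hu) ((h2 a fun _ hu => hu).2 hp)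
  · have ha' (x : M) : ¬ mem x a := fun hx => hp ⟨x, hx⟩
    have hnz : n = z := hS.ext fun c => by
      refine ⟨fun hc => (hz0 c (hn c hc)).2 fun x hx => absurd hx (ha' x), fun hc => ?_⟩
      obtain ⟨o, ho⟩ := hM.exists_empty
      have ho' (x : M) : ¬ mem x o := fun hx => (Set.ext_iff.1 ho x).1 hx
      exact (hcard c (hz c hc)).2 ⟨o, fun u hu => absurd hu (ho' u),
        fun u _ hu => absurd hu (ho' u), fun x hx => absurd hx (ha' x),
        fun x hx => absurd hx (ha' x)⟩
    rwa [hnz]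

end MSE

namespace MSE

variable {M : Type*} [MetricSpace M] {mem : M → M → Prop} {n : ℕ}

/-! ### Quotients of sets with a gap in their distances -/

/-- `q` consists of the elements of `X` at distance at most `γ` from `b`. -/
def IsClass (mem : M → M → Prop) (γ : ℝ) (X b q : M) : Prop :=
  ∀ y, mem y q ↔ mem y X ∧ dist y b ≤ γ

/-- `f` is the set of the classes of the elements of `X`. -/
def IsQuot (mem : M → M → Prop) (γ : ℝ) (X f : M) : Prop :=
  ∀ q, mem q f ↔ ∃ b, mem b X ∧ IsClass mem γ X b q

/-- The distances between elements of `X` are at most `γ` or at least `r - γ`. -/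
structure HasGap (mem : M → M → Prop) (r γ : ℝ) (X : M) : Prop where
  nonneg : 0 ≤ γ
  lt : γ < r / 3
  dist_le_or : ∀ y z, mem y X → mem z X → dist y z ≤ γ ∨ r - γ ≤ dist y z

theorem IsMetricSetStructure.min_le_eval_gap (hM : IsMetricSetStructure mem) {r : ℝ} {x : Fin n}
    {a : Fin n → M} {y z : M} (hy : mem y (a x)) (hz : mem z (a x)) :
    min (dist y z) (r - dist y z) ≤ (Formula.gap r x).eval mem a := by
  have h1 := (hM.eval_bsup_le_iff.1 (le_refl ((Formula.gap r x).eval mem a))).2 z hz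
  have h2 := (hM.eval_bsup_le_iff.1 h1).2 y hy
  simpa [Formula.eval, Formula.eval_sub, Formula.eval_const] using h2

theorem IsMetricSetStructure.eval_gap_le (hM : IsMetricSetStructure mem) {r t : ℝ} {x : Fin n}
    {a : Fin n → M} (ht : 0 ≤ t)
    (h : ∀ y z, mem y (a x) → mem z (a x) → min (dist y z) (r - dist y z) ≤ t) :
    (Formula.gap r x).eval mem a ≤ t := by
  refine hM.eval_bsup_le_iff.2 ⟨(neg_nonpos.2 (Formula.v_nonneg _)).trans ht, fun z hz =>
    hM.eval_bsup_le_iff.2 ⟨(neg_nonpos.2 (Formula.v_nonneg _)).trans ht, fun y hy => ?_⟩⟩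
  simpa [Formula.eval, Formula.eval_sub, Formula.eval_const] using h y z hy hz

namespace HasGap

variable {r γ : ℝ} {X : M}

theorem near_trans (h : HasGap mem r γ X) {x y z : M} (hx : mem x X) (hz : mem z X)
    (hxy : dist x y ≤ γ) (hyz : dist y z ≤ γ) : dist x z ≤ γ := by
  refine (h.dist_le_or x z hx hz).resolve_right fun h1 => ?_
  linarith [dist_triangle x y z, h.lt]

theorem pos (h : HasGap mem r γ X) : 0 < r := by linarith [h.nonneg, h.lt]

theorem class_eq_or_le_dist (h : HasGap mem r γ X) (hM : IsMetricSetStructure mem)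
    {b b' q q' : M} (hb : mem b X) (hb' : mem b' X) (hq : IsClass mem γ X b q)
    (hq' : IsClass mem γ X b' q') : q = q' ∨ r - γ ≤ dist q q' := by
  rcases h.dist_le_or b b' hb hb' with h1 | h1
  · refine .inl (hM.ext fun y => ?_)
    rw [hq, hq']
    refine and_congr_right fun hy => ⟨fun h2 => h.near_trans hy hb' h2 h1, fun h2 => ?_⟩
    exact h.near_trans hy hb h2 ((dist_comm b' b).trans_le h1)
  -- If the classes were closer than `r - γ`, then `b` would have a neighbour in `q'` closer than `r
  -- - γ`, hence within `γ` by the gap, which puts `b` within `γ` of `b'`. Matching is available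
  -- since `r - γ ≤ d(b, b') ≤ 1`.
  · refine .inr (not_lt.1 fun h2 => ?_)
    obtain ⟨y, hy, hby⟩ := hM.exists_dist_lt ((hq b).2 ⟨hb, by simpa using h.nonneg⟩) h2
      (h1.trans (hM.dist_le_one _ _))
    obtain ⟨hyX, hyb⟩ := (hq' y).1 hy
    have h3 := (h.dist_le_or b y hb hyX).resolve_right (not_le.2 hby)
    have h4 := h.near_trans hb hb' h3 hyb
    linarith [h.lt, h.pos]

theorem isDiscrete_quot (h : HasGap mem r γ X) (hM : IsMetricSetStructure mem) {f : M}
    (hf : IsQuot mem γ X f) : IsDiscrete mem (r - γ) f := by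
  intro q q' hq hq'
  obtain ⟨b, hb, hqb⟩ := (hf q).1 hq
  obtain ⟨b', hb', hqb'⟩ := (hf q').1 hq'
  exact h.class_eq_or_le_dist hM hb hb' hqb hqb'

/-- By the gap, `E_r` takes only the values `1` (distance at most `γ < r/3`) and `0` (distance at
least `r - γ > 2r/3`) on `X`. So `max(1 - E_r, d)` is `d` on the class and `1` off it. -/
theorem eval_dist_class (h : HasGap mem r γ X) (hM : IsMetricSetStructure mem) {b x : Fin n}
    {a : Fin n → M} (hx : a x = X) (hb : mem (a b) X) (u : M) :
    (Formula.binf x.succ (.max (.sub .one (.equivE r 0 b.succ.succ)) (.dist 1 0))).eval mem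
      (Matrix.vecCons u a) = dSet u {y | mem y X ∧ dist y (a b) ≤ γ} := by
  have hr := h.pos
  have hγ := h.lt
  refine eq_of_forall_le_iff fun t => ?_
  rw [hM.le_eval_binf_iff, le_dSet_iff]
  simp only [Matrix.cons_val_succ, hx, Formula.eval, Formula.eval_sub, Formula.equivE,
    Formula.eval_const, Matrix.cons_val_zero, Matrix.cons_val_one, Set.mem_ofPred_eq]
  have hE1 (y : M) (hy : dist y (a b) ≤ γ) :
      1 - max (min (1 / r * (2 * r - 3 * dist y (a b))) 1) 0 = 0 := by
    rw [min_eq_right, max_eq_left zero_le_one, sub_self]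
    rw [one_div, ← div_eq_inv_mul, one_le_div hr]
    linarith
  have hE0 (y : M) (hy : r - γ ≤ dist y (a b)) :
      1 - max (min (1 / r * (2 * r - 3 * dist y (a b))) 1) 0 = 1 := by
    rw [max_eq_right, sub_zero]
    refine (min_le_left _ _).trans (mul_nonpos_of_nonneg_of_nonpos (by positivity) ?_)
    linarith
  constructor
  · rintro ⟨-, h2⟩
    refine ⟨(h2 _ hb).trans (max_le ?_ (hM.dist_le_one _ _)), fun y hy => ?_⟩
    · rw [hE1 _ (by simpa using h.nonneg)]; exact zero_le_one
    · have h3 := h2 y hy.1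
      rwa [hE1 y hy.2, max_eq_right dist_nonneg] at h3
  · rintro ⟨h1, h2⟩
    refine ⟨h1.trans (le_max_right _ _), fun y hy => ?_⟩
    rcases h.dist_le_or y (a b) hy hb with h3 | h3
    · exact (h2 y ⟨hy, h3⟩).trans (le_max_right _ _)
    · rw [hE0 y h3]
      exact h1.trans (le_max_left _ _)

theorem exists_isClass (h : HasGap mem r γ X) (hM : IsModel mem) {b : M} (hb : mem b X) :
    ∃ q, IsClass mem γ X b q := by
  have hS := hM.isMetricSetStructure
  refine hM.exists_of_isDef (C := {y | mem y X ∧ dist y b ≤ γ}) ?_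
    ⟨2, _, ![b, X], h.eval_dist_class hS (b := 0) (x := 1) (a := ![b, X]) rfl hb⟩
  exact (hS.isClosed_setOf_mem X).inter (isClosed_le (f := fun y => dist y b) (by fun_prop) continuous_const)

theorem eval_distClass (h : HasGap mem r γ X) (hM : IsMetricSetStructure mem) {w b x : Fin n}
    {a : Fin n → M} {q : M} (hx : a x = X) (hb : mem (a b) X) (hq : IsClass mem γ X (a b) q) :
    (Formula.distClass r w b x).eval mem a = dist (a w) q := by
  refine hM.eval_distSet fun u => ?_
  rw [h.eval_dist_class hM hx hb, show {c | mem c q} = {y | mem y X ∧ dist y (a b) ≤ γ} from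
    Set.ext hq]

theorem eval_dist_quot (h : HasGap mem r γ X) (hM : IsModel mem) {x : Fin n}
    {a : Fin n → M} (hx : a x = X) (w : M) :
    (Formula.min .one (.binf x.succ (.distClass r 1 0 x.succ.succ))).eval mem
      (Matrix.vecCons w a) = dSet w {q | ∃ b, mem b X ∧ IsClass mem γ X b q} := by
  have hS := hM.isMetricSetStructure
  refine eq_of_forall_le_iff fun t => ?_
  rw [Formula.eval, Formula.eval, le_min_iff, hS.le_eval_binf_iff, le_dSet_iff]
  refine and_congr_right fun ht => ?_
  have hv : t ≤ (Formula.distClass r (1 : Fin (n + 2)) 0 x.succ.succ).v :=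
    ht.trans (Formula.one_le_v_distSet _ _)
  rw [and_iff_right hv, Matrix.cons_val_succ, hx]
  have key (b q : M) (hb : mem b X) (hq : IsClass mem γ X b q) :=
    h.eval_distClass hS (w := 1) (b := 0) (x := x.succ.succ)
      (a := Matrix.vecCons b (Matrix.vecCons w a)) (by simpa using hx) (by simpa using hb)
      (by simpa using hq)
  constructor
  · rintro h1 q ⟨b, hb, hq⟩
    have h2 := h1 b hb
    rwa [key b q hb hq] at h2
  · intro h1 b hb
    obtain ⟨q, hq⟩ := h.exists_isClass hM hb
    rw [key b q hb hq]
    exact h1 q ⟨b, hb, hq⟩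

theorem exists_isQuot (h : HasGap mem r γ X) (hM : IsModel mem) : ∃ f, IsQuot mem γ X f := by
  refine hM.exists_of_isDef (C := {q | ∃ b, mem b X ∧ IsClass mem γ X b q}) ?_
    ⟨1, _, ![X], h.eval_dist_quot hM (x := 0) (a := ![X]) rfl⟩
  refine isClosed_of_forall_eq_or_le_dist (δ := r - γ) (by linarith [h.lt, h.pos]) ?_
  rintro q ⟨b, hb, hq⟩ q' ⟨b', hb', hq'⟩
  exact h.class_eq_or_le_dist hM.isMetricSetStructure hb hb' hq hq'

theorem eval_distQuot (h : HasGap mem r γ X) (hM : IsModel mem) {x z : Fin n} {a : Fin n → M}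
    {f : M} (hx : a x = X) (hf : IsQuot mem γ X f) :
    (Formula.distQuot r x z).eval mem a = dist (a z) f := by
  refine hM.isMetricSetStructure.eval_distSet fun w => ?_
  rw [h.eval_dist_quot hM hx, show {c | mem c f} = {q | ∃ b, mem b X ∧ IsClass mem γ X b q} from
    Set.ext hf]

end HasGap

/-! ### The axioms of infinity -/

/-- A crude bound that needs only `D ≥ 0`. It is used where no discreteness is available and `D`
need not be a distance. -/
theorem IsMetricSetStructure.eval_supRel_le (hM : IsMetricSetStructure mem) [Nonempty M]
    {D φ : Formula (n + 1)} {a : Fin n → M} {t : ℝ} (ht : 0 ≤ t)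
    (hD : ∀ w, 0 ≤ D.eval mem (Matrix.vecCons w a))
    (hφ : ∀ w, φ.eval mem (Matrix.vecCons w a) ≤ t) : (Formula.supRel D φ).eval mem a ≤ t := by
  rw [Formula.supRel, hM.eval_sup_le_iff]
  simp only [Formula.eval, Formula.eval_const, Formula.eval_sub]
  refine fun w => max_le ?_ ((neg_nonpos.2 φ.v_nonneg).trans ht)
  have := mul_nonneg (mul_nonneg zero_le_two φ.v_nonneg) (hD w)
  linarith [hφ w]

theorem Ty.eval_distPred_pow_nonneg {k : ℕ} (t : Ty k) (ι : Fin k → Fin n) (w : Fin n)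
    (a : Fin n → M) : 0 ≤ (t.pow.distPred ι w).eval mem a := by
  rw [Ty.distPred, Formula.eval, Formula.eval_const]
  exact le_max_left _ _

/-- `Inf` asserts `¬ (n ⊑ x)` for some inductive `x`. Distances are at most `1`, so `⟦n ⊑ x⟧_ε ≥ 1 -
1/ε`, and this conjunct alone is at most `1/ε`. For `ε = r/3 > 1` it excludes the axiom. -/
theorem IsModel.eval_infinite_le (hM : IsModel mem) {ε : ℝ} (hε : 0 < ε) (ι : Fin 1 → Fin n)
    (a : Fin n → M) : (DisFormula.infinite.toFormula ε ι Env.nil).eval mem a ≤ 1 / ε := by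
  have hS := hM.isMetricSetStructure
  have := hM.nonempty
  have hε' : 0 ≤ 1 / ε := by positivity
  rw [DisFormula.infinite, DisFormula.toFormula]
  refine hS.eval_supRel_le hε' (fun w => Ty.eval_distPred_pow_nonneg _ _ _ _) fun w => ?_
  rw [DisFormula.toFormula, Formula.eval]
  refine (min_le_right _ _).trans ?_
  rw [DisFormula.isNat, DisFormula.all, DisFormula.toFormula, DisFormula.toFormula,
    DisFormula.toFormula, Formula.eval_sub, Formula.eval_sub, Formula.eval, sub_sub_cancel]
  refine hS.eval_supRel_le hε' (fun w => Ty.eval_distPred_pow_nonneg _ _ _ _) fun w' => ?_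
  rw [DisFormula.imp, DisFormula.toFormula, DisFormula.toFormula, DisFormula.toFormula,
    Formula.eval_sub, Formula.eval_sub, Formula.eval, sub_sub_cancel, Formula.eval]
  refine (min_le_right _ _).trans ?_
  rw [DisFormula.toFormula, DisFormula.toFormula, Formula.eval_sub, Formula.eval, Formula.eval,
    Formula.eval_sub, Formula.eval, Formula.eval, hS.eval_e, sub_le_comm]
  refine le_trans ?_ (le_max_left _ _)
  exact sub_le_sub_left (mul_le_of_le_one_right hε' (dSet_le_one _ _)) 1

/-- The value of `⟦Inf(z)⟧_{r/3}` for a discrete set `z`. -/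
theorem IsModel.eval_infinite (hM : IsModel mem) {ε : ℝ} (hε : 0 < ε) (hε1 : ε ≤ 1) {f X : M}
    (hf : IsDiscrete mem ε f) :
    (IsInf mem f →
      1 ≤ (DisFormula.infinite.toFormula ε (fun _ => 0) Env.nil).eval mem ![f, X]) ∧
    (¬ IsInf mem f →
      (DisFormula.infinite.toFormula ε (fun _ => 0) Env.nil).eval mem ![f, X] ≤ 0) := by
  rw [isInf_iff_sat]
  exact DisFormula.eval_toFormula hM hε hε1 (fun _ => hf) _
    (DisFormula.eqHomogeneous_infinite.eqDiscrete hM.isMetricSetStructure hε1 fun _ => hf)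
    _ _ _ _ (fun _ => rfl) (fun _ x => nomatch x) (fun _ x => nomatch x)

variable {r ε s : ℝ}

theorem IsModel.exists_isDiscrete_of_satInf (hM : IsModel mem) (hε : 0 < ε)
    (hεr : ε < r / 3) (h : SatInf mem r ε) (hs : s < r - ε) :
    ∃ a, IsDiscrete mem s a ∧ IsInf mem a := by
  have hS := hM.isMetricSetStructure
  have := hM.nonempty
  have hr : 0 < r := by linarith
  -- In turn: `1 - δ > 0` decides the truth of `Inf(f)`, `ε + δ < r/3` gives the gap, the third
  -- bound gives `s`-discreteness, and the last makes `1 - δ` exceed `3/r` when `r > 3`.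
  obtain ⟨δ, hδ, hδ1, hδ2, hδ3, hδ4⟩ : ∃ δ : ℝ, 0 < δ ∧ δ < 1 ∧ ε + δ < r / 3 ∧ s ≤ r - (ε + δ) ∧
      (3 < r → δ < 1 - 3 / r) := by
    have h1 : ∀ᶠ δ in nhdsWithin (0 : ℝ) (Set.Ioi 0), δ < 1 :=
      mem_nhdsWithin_of_mem_nhds (Iio_mem_nhds one_pos)
    have h2 : ∀ᶠ δ in nhdsWithin (0 : ℝ) (Set.Ioi 0), δ < r / 3 - ε :=
      mem_nhdsWithin_of_mem_nhds (Iio_mem_nhds (by linarith))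
    have h3 : ∀ᶠ δ in nhdsWithin (0 : ℝ) (Set.Ioi 0), δ < r - ε - s :=
      mem_nhdsWithin_of_mem_nhds (Iio_mem_nhds (by linarith))
    have h4 : ∀ᶠ δ in nhdsWithin (0 : ℝ) (Set.Ioi 0), 3 < r → δ < 1 - 3 / r := by
      by_cases h5 : 3 < r
      · simp only [h5, true_imp_iff]
        refine mem_nhdsWithin_of_mem_nhds (Iio_mem_nhds ?_)
        rw [sub_pos, div_lt_one hr]
        exact h5
      · simp [h5]
    obtain ⟨δ, h1, h2, h3, h4, h5⟩ :=
      (h1.and (h2.and (h3.and (h4.and self_mem_nhdsWithin)))).exists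
    exact ⟨δ, h5, h1, by linarith, by linarith, h4⟩
  obtain ⟨X, hX⟩ : ∃ X : M, 1 - δ < (Formula.min (.sub (.const (1 + ε)) (.gap r 0))
      (.subst (.distQuot r 1 0) (DisFormula.infinite.toFormula (r / 3) (fun _ => 0) Env.nil))).eval
      mem ![X] := by
    by_contra! hc
    have h1 : (Formula.infinity r ε).eval mem ![] ≤ 1 - δ := hS.eval_sup_le_iff.2 hc
    rw [SatInf] at h
    linarith
  rw [Formula.eval, Formula.eval_sub, Formula.eval_const, lt_min_iff] at hX
  obtain ⟨hX1, hX2⟩ := hX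
  have hgap : HasGap mem r (ε + δ) X := by
    refine ⟨by linarith, hδ2, fun y z hy hz => ?_⟩
    have h1 := hS.min_le_eval_gap (r := r) (x := 0) (a := ![X]) hy hz
    rcases min_le_iff.1 h1 with h2 | h2
    · left; linarith
    · right; linarith
  obtain ⟨f, hf⟩ := hgap.exists_isQuot hM
  have hdisc := hgap.isDiscrete_quot hS hf
  -- At `z = f` the penalty vanishes, leaving `⟦Inf(f)⟧_{r/3} ≥ 1 - δ`.
  have hval := hS.le_eval_inf_iff.1 hX2.le f
  rw [Formula.eval, Formula.eval, hgap.eval_distQuot hM (x := 1) rfl hf] at hval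
  simp only [Matrix.cons_val_zero, dist_self, mul_zero, add_zero] at hval
  refine ⟨f, fun b c hb hc => (hdisc b c hb hc).imp_right hδ3.trans, ?_⟩
  by_contra hinf
  rcases le_or_gt r 3 with hr3 | hr3
  · have h1 := (hM.eval_infinite (ε := r / 3) (X := X) (by positivity) (by linarith)
      fun b c hb hc => (hdisc b c hb hc).imp_right fun h => by linarith).2 hinf
    linarith
  · have h1 := hM.eval_infinite_le (ε := r / 3) (by positivity) (fun _ => 0) ![f, X]
    rw [one_div_div] at h1
    linarith [hδ4 hr3]

theorem IsModel.satInf_of_exists_isDiscrete (hM : IsModel mem) (hε : 0 < ε) (hεr : ε < r / 3)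
    (h : ∀ s : ℝ, 0 < s → s < r - ε → ∃ a : M, IsDiscrete mem s a ∧ IsInf mem a) :
    SatInf mem r ε := by
  have hS := hM.isMetricSetStructure
  have := hM.nonempty
  have hr : 0 < r := by linarith
  rcases le_or_gt r 3 with hr3 | hr3
  · refine le_of_forall_sub_le fun η hη => ?_
    -- `s > 2r/3` gives `a` a gap with `γ = r - s < r/3`, and `s ≥ r - ε - η` makes `φ_r(a) ≤ ε +
    -- η`.
    obtain ⟨s, hs1, hs2, hs3⟩ : ∃ s, 2 * r / 3 < s ∧ r - ε - η ≤ s ∧ s < r - ε :=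
      ⟨max (r - ε - η) ((2 * r / 3 + (r - ε)) / 2), lt_max_of_lt_right (by linarith),
        le_max_left _ _, max_lt (by linarith) (by linarith)⟩
    obtain ⟨a, ha, hinf⟩ := h s (by linarith) hs3
    have hgap : HasGap mem r (r - s) a := by
      refine ⟨by linarith, by linarith, fun y z hy hz => ?_⟩
      rcases ha y z hy hz with rfl | h1
      · left; rw [dist_self]; linarith
      · right; linarith
    obtain ⟨f, hf⟩ := hgap.exists_isQuot hM
    have hdisc := hgap.isDiscrete_quot hS hf
    -- Since `r - s < s`, two elements of `a` within `r - s` of each other coincide, so the classes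
    -- are singletons.
    have hsing : ∀ y, mem y f ↔ ∃ b, mem b a ∧ {c | mem c y} = {b} := by
      intro q
      rw [hf q]
      refine exists_congr fun b => and_congr_right fun hb => ?_
      rw [Set.ext_iff]
      refine forall_congr' fun y => iff_congr Iff.rfl ?_
      refine ⟨fun ⟨hy, hyb⟩ => (ha y b hy hb).resolve_right fun h1 => ?_, ?_⟩
      · linarith
      · rintro rfl
        exact ⟨hb, by rw [dist_self]; linarith⟩
    have hinf' := (hM.isInf_iff_isInf_singletons (δ := r / 3) (by positivity) (by linarith)
      (fun b c hb hc => (ha b c hb hc).imp_right fun h => by linarith) hsing).1 hinf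
    have hval := (hM.eval_infinite (ε := r / 3) (X := a) (by positivity) (by linarith)
      fun b c hb hc => (hdisc b c hb hc).imp_right fun h => by linarith).1 hinf'
    refine le_trans ?_ (hS.eval_sup_le_iff.1 (le_refl ((Formula.infinity r ε).eval mem ![])) a)
    rw [Formula.eval, Formula.eval_sub, Formula.eval_const]
    refine le_min ?_ ((sub_le_self 1 hη.le).trans (hS.le_eval_inf_iff.2 fun y => ?_))
    · have h1 := hS.eval_gap_le (r := r) (x := 0) (a := ![a]) (t := r - s) (by linarith)
        fun y z hy hz => by
          rcases hgap.dist_le_or y z hy hz with h1 | h1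
          · exact min_le_of_left_le h1
          · exact min_le_of_right_le (by linarith)
      linarith
    · rw [Formula.eval, Formula.eval, hgap.eval_distQuot hM (x := 1) rfl hf]
      -- Moving from `f` to `y` changes `⟦Inf⟧` by at most `2v·d(f, y)`, exactly what the penalty
      -- adds.
      have h1 := hS.eval_vecCons_le
        (DisFormula.infinite.toFormula (r / 3) (fun _ => 0) Env.nil) ![a] f y
      rw [dist_comm] at h1
      exact hval.trans h1
  -- Here `r - ε > 2r/3 > 2`, so `s = 2` is admissible; a `2`-discrete set has at most one element.
  · obtain ⟨a, ha, hinf⟩ := h 2 two_pos (by linarith)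
    refine absurd hinf (hM.not_isInf_of_subsingleton fun x y hx hy =>
      (ha x y hx hy).resolve_right fun h1 => ?_)
    linarith [hS.dist_le_one x y]

end MSE

theorem mainTheorem11 {M : Type*} [MetricSpace M] (mem : M → M → Prop) (hM : MSE.IsModel mem) :
    (∀ r ε : ℝ, 0 < r → 0 < ε → ε < r / 3 →
      (MSE.SatInf mem r ε ↔
        ∀ s : ℝ, 0 < s → s < r - ε → ∃ a : M, MSE.IsDiscrete mem s a ∧ MSE.IsInf mem a)) ∧
    (MSE.SatInfScheme mem ↔
      ∀ r : ℝ, 0 < r → r < 1 → ∃ a : M, MSE.IsDiscrete mem r a ∧ MSE.IsInf mem a) := by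
  refine ⟨fun r ε _ hε hεr => ⟨fun h s _ hs => hM.exists_isDiscrete_of_satInf hε hεr h hs,
    hM.satInf_of_exists_isDiscrete hε hεr⟩, fun h s hs hs1 => ?_, fun h ε hε hε1 => ?_⟩
  -- `ε = min((1 - s)/2, 1/4)` satisfies both `ε < 1/3` and `s < 1 - ε`.
  · have h1 := min_le_left ((1 - s) / 2) (1 / 4)
    have h2 := min_le_right ((1 - s) / 2) (1 / 4)
    have h3 : 0 < min ((1 - s) / 2) (1 / 4 : ℝ) := lt_min (by linarith) (by norm_num)
    exact hM.exists_isDiscrete_of_satInf h3 (by linarith) (h _ h3 (by linarith)) (by linarith)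
  · exact hM.satInf_of_exists_isDiscrete hε hε1 fun s hs hs1 => h s hs (by linarith)
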